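/- **Conventions.** Let $\mathbb K\in\{\mathbb R,\mathbb C\}$. A Lie group is a Hausdorff smooth manifold modelled on a (Hausdorff) locally convex $\mathbb K$-vector space with smooth multiplication and inversion, where smooth means $C^n$ for all $n$ in the Michal–Bastiani sense (all directional derivatives exist, $df$ is continuous and inductively $C^{n-1}$). $\mathrm{Aut}$ of a Lie group is the group of its smooth automorphisms with smooth inverse. Let $G,N$ be Lie groups, $Z(N)$ the centre of $N$ and $C_N(n)(n')=nn'n^{-1}$. $C^p_s(G,N)$ ($p=1,2$) is the set of maps $G^p\to N$ that are smooth on an identity neighbourhood and take the value $1$ whenever one of the arguments is $1$; $C^2_{ss}(G,N)$ consists of those $\omega\in C^2_s(G,N)$ such that for every $g\in G$ the map $x\mapsto\omega(g,x)\,\omega(gxg^{-1},g)^{-1}$ is smooth on an identity neighbourhood. A *smooth outer action* is a map $S:G\to\mathrm{Aut}(N)$ with $S(1)=\mathrm{id}$, with $(g,n)\mapsto S(g)(n)$ smooth on $U\times N$ for some open identity neighbourhood $U$, and such that $S(g)S(g')S(gg')^{-1}=C_N(\omega(g,g'))$ for some $\omega\in C^2_s(G,N)$. Write $S\sim S'$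 if $S'=(C_N\circ h)\cdot S$ for some $h\in C^1_s(G,N)$. Then $g.z=S(g)(z)$ is an action of $G$ on $Z(N)$, and with the usual group differential $d_S$ and with $C^p_s(G,Z(N))$, $C^2_{ss}(G,Z(N))$ the $Z(N)$-valued elements of $C^p_s(G,N)$, $C^2_{ss}(G,N)$, put $$Z^1_s(G,Z(N))_S=\ker d_S|_{C^1_s(G,Z(N))},\qquad H^2_{ss}(G,Z(N))_S=\ker d_S|_{C^2_{ss}(G,Z(N))}\big/ d_S(C^1_s(G,Z(N))).$$ A *Lie group extension* of $G$ by $N$ is a short exact sequence $1\to N\xrightarrow{\iota}\widehat G\xrightarrow{q}G\to1$ of Lie group morphisms making $\widehat G$ a smooth (locally trivial) principal $N$-bundle over $G$. A section $\sigma\in C^1_s(G,\widehat G)$ of $q$ defines its factor system $(S',\omega)$ by $\iota(S'(g)(n))=\sigma(g)\iota(n)\sigma(g)^{-1}$ and $\iota(\omega(g,g'))=\sigma(g)\sigma(g')\sigma(gg')^{-1}$; two extensions with a common factor system are equivalent, and the extension *has kernel $[S]$* if $S'\sim S$. The group $H^2_{ss}(G,Z(N))_S$ acts on equivalence classes of extensions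 with kernel $[S]$: $[\widehat G']=[\beta].[\widehat G]$ iff, for some $\beta$ in the given cohomology class and some $\omega$, $\widehat G$ has factor system $(S,\omega)$ and $\widehat G'$ has factor system $(S,\beta\cdot\omega)$. For $(\varphi,\psi)\in\mathrm{Aut}(N)\times\mathrm{Aut}(G)$ let $(\varphi,\psi).[\widehat G]$ be the class of $1\to N\xrightarrow{\iota\circ\varphi^{-1}}\widehat G\xrightarrow{\psi\circ q}G\to1$, and put $$\mathrm{Comp}(S)=\{(\varphi,\psi)\in\mathrm{Aut}(N)\times\mathrm{Aut}(G):\ (g\mapsto \varphi\, S(\psi^{-1}(g))\,\varphi^{-1})\sim S\},$$ a group acting on $H^2_{ss}(G,Z(N))_S$ by $(\varphi,\psi).[\beta]=[\varphi\circ\beta\circ(\psi^{-1}\times\psi^{-1})]$. Finally $\mathrm{Aut}(\widehat G,N)=\{\nu\in\mathrm{Aut}(\widehat G):\nu(\iota(N))=\iota(N)\}$. **Theorem A.9.** Let $S$ be a smooth outer action of $G$ on $N$ and $1\to N\xrightarrow{\iota}\widehat G\xrightarrow{q}G\to1$ a Lie group extension with kernel $[S]$. Then: 1. $\Psi(f)(x)=\iota(f(q(x)))\,x$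 defines a group homomorphism $\Psi:Z^1_s(G,Z(N))_S\to\mathrm{Aut}(\widehat G,N)$. 2. There is a group homomorphism $\Phi:\mathrm{Aut}(\widehat G,N)\to\mathrm{Comp}(S)$, $\nu\mapsto(\nu_N,\nu_G)$, with $\iota\circ\nu_N=\nu\circ\iota$ and $\nu_G\circ q=q\circ\nu$. 3. For each $(\varphi,\psi)\in\mathrm{Comp}(S)$ there is a unique class $I(\varphi,\psi)\in H^2_{ss}(G,Z(N))_S$ with $(\varphi,\psi).[\widehat G]=I(\varphi,\psi).[\widehat G]$, and $I$ is a $1$-cocycle: $I(pp')=p.I(p')+I(p)$ for $p,p'\in\mathrm{Comp}(S)$. 4. The sequence $$1\to Z^1_s(G,Z(N))_S\xrightarrow{\Psi}\mathrm{Aut}(\widehat G,N)\xrightarrow{\Phi}\mathrm{Comp}(S)\xrightarrow{I}H^2_{ss}(G,Z(N))_S$$ is exact: $\Psi$ is injective, $\mathrm{im}\,\Psi=\ker\Phi$ and $\mathrm{im}\,\Phi=I^{-1}(0)$. -/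

import Mathlib

open Filter Topology Set
open scoped ComplexOrder IsMulCommutative

universe u v w

/-- Hausdorff locally convex topological vector spaces over `K` (real or complex). -/
class LocallyConvexTVS (K : Type*) (E : Type*) [RCLike K] [AddCommGroup E] [Module K E]
    [TopologicalSpace E] : Prop extends
    IsTopologicalAddGroup E, ContinuousSMul K E, LocallyConvexSpace K E, T2Space E

instance LocallyConvexTVS.prod (K : Type*) (E F : Type*) [RCLike K] [AddCommGroup E] [Module K E]
    [TopologicalSpace E] [LocallyConvexTVS K E] [AddCommGroup F] [Module K F]
    [TopologicalSpace F] [LocallyConvexTVS K F] : LocallyConvexTVS K (E × F) where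

/-- `df(x)(h) = y`: the difference quotients `t⁻¹ (f (x + t h) - f x)` tend to `y` as `t → 0` in `K`. -/
def HasDirDerivAt (K : Type*) [RCLike K] {X Y : Type*} [AddCommGroup X] [Module K X]
    [AddCommGroup Y] [Module K Y] [TopologicalSpace Y] (f : X → Y) (x h : X) (y : Y) : Prop :=
  Tendsto (fun t : K => t⁻¹ • (f (x + t • h) - f x)) (𝓝[≠] 0) (𝓝 y)

/-- `f` is a `Cⁿ`-map on the open set `U` in the sense of Michal and Bastiani (Keller's `Cⁿ_c`): `f` is
continuous, all directional derivatives exist on `U`, and `df : U × X → Y` is continuous and, inductively,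
a `Cⁿ⁻¹`-map. Smooth means `Cⁿ` for all `n`. -/
def CnOn (K : Type*) [RCLike K] {Y : Type v} [AddCommGroup Y] [Module K Y]
    [TopologicalSpace Y] : ℕ → ∀ {X : Type u} [AddCommGroup X] [Module K X]
    [TopologicalSpace X], (X → Y) → Set X → Prop
  | 0, _, _, _, _, f, U => ContinuousOn f U
  | n + 1, X, _, _, _, f, U => ContinuousOn f U ∧ ∃ df : X × X → Y,
      (∀ x ∈ U, ∀ h, HasDirDerivAt K f x h (df (x, h))) ∧ ContinuousOn df (U ×ˢ univ) ∧
        CnOn K n df (U ×ˢ univ)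

theorem CnOn.continuousOn {K : Type*} [RCLike K] {X : Type u} [AddCommGroup X]
    [Module K X] [TopologicalSpace X] {Y : Type v} [AddCommGroup Y] [Module K Y]
    [TopologicalSpace Y] {n : ℕ} {f : X → Y} {U : Set X} (h : CnOn K n f U) :
    ContinuousOn f U := by
  cases n with
  | zero => exact h
  | succ n => exact h.1

section Calculus

variable {K : Type*} [RCLike K]
variable {X : Type u} [AddCommGroup X] [Module K X] [TopologicalSpace X] [LocallyConvexTVS K X]
variable {Y : Type v} [AddCommGroup Y] [Module K Y] [TopologicalSpace Y] [LocallyConvexTVS K Y]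
variable {Z : Type w} [AddCommGroup Z] [Module K Z] [TopologicalSpace Z] [LocallyConvexTVS K Z]

theorem HasDirDerivAt.comp_curve {g : Y → Z} {V : Set Y} (hV : IsOpen V) {dg : Y × Y → Z}
    (hdg : ∀ y ∈ V, ∀ h, HasDirDerivAt K g y h (dg (y, h)))
    (hc : ContinuousOn dg (V ×ˢ univ)) {y : Y} (hy : y ∈ V) {k : K → Y} {k0 : Y}
    (hk : Tendsto k (𝓝[≠] 0) (𝓝 k0)) :
    Tendsto (fun t : K => t⁻¹ • (g (y + t • k t) - g y)) (𝓝[≠] 0) (𝓝 (dg (y, k0))) := by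
  let _ : Module ℝ Z := .restrictScalars ℝ K Z
  have _ : IsScalarTower ℝ K Z := .restrictScalars ℝ K Z
  have _ : ContinuousSMul ℝ Z := IsScalarTower.continuousSMul K
  have hconv : ∀ s : Set Z, Convex K s → Convex ℝ s := by
    intro s hs x hx y hy a b ha hb hab
    have := hs hx hy (a := (a : K)) (b := (b : K)) (by exact_mod_cast ha) (by exact_mod_cast hb)
      (by exact_mod_cast hab)
    simpa only [algebraMap_smul, ← RCLike.algebraMap_eq_ofReal] using this
  have _ : LocallyConvexSpace ℝ Z := by
    refine ⟨fun x => ?_⟩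
    refine (LocallyConvexSpace.convex_basis (𝕜 := K) x).to_hasBasis
      (fun s hs => ⟨s, ⟨hs.1, hconv s hs.2⟩, subset_rfl⟩) (fun s hs => ?_)
    obtain ⟨t, ht, hts⟩ := (LocallyConvexSpace.convex_basis (𝕜 := K) x).mem_iff.1 hs.1
    exact ⟨t, ht, hts⟩
  intro W hW
  obtain ⟨W1, hW1, hW1c, hW1W⟩ := exists_mem_nhds_isClosed_subset hW
  obtain ⟨C0, ⟨hC0, hC0c⟩, hC0W⟩ :=
    (LocallyConvexSpace.convex_basis (𝕜 := ℝ) (dg (y, k0))).mem_iff.1 hW1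
  have hCc : Convex ℝ (closure C0) := hC0c.closure
  have hCW : closure C0 ⊆ W := (closure_minimal hC0W hW1c).trans hW1W
  have hopen : IsOpen (V ×ˢ (univ : Set Y)) := hV.prod isOpen_univ
  have hmem : (y, k0) ∈ V ×ˢ (univ : Set Y) := ⟨hy, mem_univ _⟩
  have hev : ∀ᶠ p in 𝓝 (y, k0), p ∈ V ×ˢ (univ : Set Y) ∧ dg p ∈ closure C0 :=
    (hopen.eventually_mem hmem).and
      ((hc.continuousAt (hopen.mem_nhds hmem)).eventually
        (mem_of_superset hC0 subset_closure))
  rw [nhds_prod_eq, eventually_prod_iff] at hev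
  obtain ⟨pa, hpa, pb, hpb, hab⟩ := hev
  have hpa' : ∀ᶠ z in 𝓝 (0 : Y), pa (y + z) := by
    have : Tendsto (fun z : Y => y + z) (𝓝 0) (𝓝 y) := by
      simpa using (tendsto_const_nhds (x := y)).add (tendsto_id (α := Y) (x := 𝓝 0))
    exact this.eventually hpa
  obtain ⟨B, ⟨hB, hBb⟩, hBs⟩ := (nhds_basis_balanced K Y).mem_iff.1 hpa'
  have ht0 : Tendsto (fun t : K => t • k t) (𝓝[≠] 0) (𝓝 0) := by
    simpa using (tendsto_nhdsWithin_of_tendsto_nhds (tendsto_id (x := 𝓝 (0:K)))).smul hk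
  rw [mem_map]
  filter_upwards [ht0.eventually hB, hk.eventually hpb, self_mem_nhdsWithin] with t htB htk htne
  have htne : t ≠ 0 := htne
  apply hCW
  by_contra hD
  obtain ⟨f, a, hfa, hfD⟩ := geometric_hahn_banach_closed_point hCc isClosed_closure hD
  set F : ℝ → Z := fun s => t⁻¹ • g (y + (s : K) • (t • k t)) with hF
  have hin : ∀ s ∈ Icc (0:ℝ) 1, (y + (s : K) • (t • k t)) ∈ V ∧
      dg (y + (s : K) • (t • k t), k t) ∈ closure C0 := by
    intro s hs
    have h1 : (s : K) • (t • k t) ∈ B := hBb.smul_mem (by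
      rw [RCLike.norm_ofReal, abs_of_nonneg hs.1]; exact hs.2) htB
    have := hab (hBs h1) htk
    exact ⟨this.1.1, this.2⟩
  have hder : ∀ s ∈ Icc (0:ℝ) 1,
      HasDerivAt (fun s => f (F s)) (f (dg (y + (s : K) • (t • k t), k t))) s := by
    intro s hs
    rw [hasDerivAt_iff_tendsto_slope_zero]
    have h1 := hdg _ (hin s hs).1 (k t)
    have h2 : Tendsto (fun r : ℝ => (r : K) * t) (𝓝[≠] 0) (𝓝[≠] 0) := by
      refine tendsto_nhdsWithin_iff.2 ⟨?_, ?_⟩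
      · refine tendsto_nhdsWithin_of_tendsto_nhds ?_
        have : Continuous (fun r : ℝ => (r : K) * t) := by fun_prop
        simpa using this.tendsto 0
      · filter_upwards [self_mem_nhdsWithin] with r hr
        exact mul_ne_zero (by exact_mod_cast hr) htne
    have h3 := (f.continuous.tendsto _).comp (h1.comp h2)
    refine h3.congr' ?_
    filter_upwards [self_mem_nhdsWithin] with r hr
    have hr' : (r : K) ≠ 0 := by exact_mod_cast hr
    simp only [Function.comp, hF]
    rw [← map_sub, ← map_smul, ← smul_sub]
    congr 1
    rw [← algebraMap_smul K r⁻¹, RCLike.algebraMap_eq_ofReal, RCLike.ofReal_inv, mul_inv,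
      mul_smul (r : K)⁻¹, mul_smul (r : K) t, RCLike.ofReal_add, add_smul, add_assoc]
  obtain ⟨c, hc, hcs⟩ := exists_hasDerivAt_eq_slope (fun s => f (F s)) _ (zero_lt_one' ℝ)
    (fun s hs => (hder s hs).continuousAt.continuousWithinAt)
    (fun s hs => hder s (Ioo_subset_Icc_self hs))
  have h1 := hfa _ (hin c (Ioo_subset_Icc_self hc)).2
  rw [hcs] at h1
  simp only [hF, ← map_sub, ← smul_sub, RCLike.ofReal_one, RCLike.ofReal_zero, one_smul, zero_smul,
    add_zero, sub_zero, div_one] at h1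
  exact lt_asymm h1 hfD

theorem HasDirDerivAt.congr {f f' : X → Y} {x h : X} {y : Y} {U : Set X} (hU : IsOpen U)
    (hx : x ∈ U) (hff : EqOn f f' U) (hd : HasDirDerivAt K f x h y) :
    HasDirDerivAt K f' x h y := by
  refine Tendsto.congr' ?_ hd
  have h1 : Tendsto (fun t : K => x + t • h) (𝓝[≠] 0) (𝓝 x) := by
    refine tendsto_nhdsWithin_of_tendsto_nhds ?_
    have : Continuous (fun t : K => x + t • h) := by fun_prop
    simpa using this.tendsto 0
  filter_upwards [h1.eventually (hU.mem_nhds hx)] with t ht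
  rw [hff ht, hff hx]

theorem CnOn.congr {n : ℕ} {f f' : X → Y} {U : Set X} (hU : IsOpen U) (hff : EqOn f f' U)
    (hf : CnOn K n f U) : CnOn K n f' U := by
  cases n with
  | zero => exact ContinuousOn.congr hf hff.symm
  | succ n =>
    obtain ⟨h1, df, h2, h3, h4⟩ := hf
    exact ⟨h1.congr hff.symm, df, fun x hx h => (h2 x hx h).congr hU hx hff, h3, h4⟩

theorem CnOn.mono {n : ℕ} : ∀ {X : Type u} [AddCommGroup X] [Module K X] [TopologicalSpace X]
    {f : X → Y} {U V : Set X}, V ⊆ U → CnOn K n f U → CnOn K n f V := by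
  induction n with
  | zero => intro X _ _ _ f U V hVU hf; exact ContinuousOn.mono hf hVU
  | succ n ih =>
    intro X _ _ _ f U V hVU hf
    obtain ⟨h1, df, h2, h3, h4⟩ := hf
    have hs : V ×ˢ (univ : Set X) ⊆ U ×ˢ univ := prod_mono hVU subset_rfl
    exact ⟨h1.mono hVU, df, fun x hx h => h2 x (hVU hx) h, h3.mono hs, ih hs h4⟩

theorem CnOn.of_succ {n : ℕ} : ∀ {X : Type u} [AddCommGroup X] [Module K X]
    [TopologicalSpace X] {f : X → Y} {U : Set X}, CnOn K (n + 1) f U → CnOn K n f U := by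
  induction n with
  | zero => intro X _ _ _ f U hf; exact hf.1
  | succ n ih =>
    intro X _ _ _ f U hf
    obtain ⟨h1, df, h2, h3, h4⟩ := hf
    exact ⟨h1, df, h2, h3, ih h4⟩

theorem CnOn.of_locally {n : ℕ} : ∀ {X : Type u} [AddCommGroup X] [Module K X]
    [TopologicalSpace X] [LocallyConvexTVS K X] {f : X → Y} {U : Set X},
    (∀ x ∈ U, ∃ V, IsOpen V ∧ x ∈ V ∧ V ⊆ U ∧ CnOn K n f V) → CnOn K n f U := by
  have hcont : ∀ {X : Type u} [TopologicalSpace X] {f : X → Y} {U : Set X},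
      (∀ x ∈ U, ∃ V, IsOpen V ∧ x ∈ V ∧ ContinuousOn f V) → ContinuousOn f U := by
    intro X _ f U h x hx
    obtain ⟨V, hV, hxV, hc⟩ := h x hx
    exact (hc.continuousAt (hV.mem_nhds hxV)).continuousWithinAt
  induction n with
  | zero =>
    intro X _ _ _ _ f U h
    refine hcont fun x hx => ?_
    obtain ⟨V, hV, hxV, -, hc⟩ := h x hx
    exact ⟨V, hV, hxV, hc⟩
  | succ n ih =>
    intro X _ _ _ _ f U h
    choose! V hV hxV hVU hc using h
    have hcf := fun x (hx : x ∈ U) => (hc x hx).1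
    choose! df hd hdc hdn using fun x (hx : x ∈ U) => (hc x hx).2
    set d : X × X → Y := fun p => df p.1 p with hdd
    have heq : ∀ x ∈ U, EqOn (df x) d (V x ×ˢ univ) := by
      rintro x hx ⟨y, h⟩ ⟨hy, -⟩
      have hyU := hVU x hx hy
      exact tendsto_nhds_unique (hd x hx y hy h) (hd y hyU y (hxV y hyU) h)
    refine ⟨hcont fun x hx => ⟨V x, hV x hx, hxV x hx, hcf x hx⟩, d,
      fun x hx h => hd x hx x (hxV x hx) h, hcont ?_, ih ?_⟩
    · rintro ⟨x, h⟩ ⟨hx, -⟩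
      exact ⟨V x ×ˢ univ, (hV x hx).prod isOpen_univ, ⟨hxV x hx, mem_univ _⟩,
        (hdc x hx).congr (heq x hx).symm⟩
    · rintro ⟨x, h⟩ ⟨hx, -⟩
      exact ⟨V x ×ˢ univ, (hV x hx).prod isOpen_univ, ⟨hxV x hx, mem_univ _⟩,
        prod_mono (hVU x hx) subset_rfl,
        (hdn x hx).congr ((hV x hx).prod isOpen_univ) (heq x hx)⟩

theorem CnOn.const {n : ℕ} : ∀ {X : Type u} [AddCommGroup X] [Module K X]
    [TopologicalSpace X] (c : Y) (U : Set X), CnOn K n (fun _ : X => c) U := by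
  induction n generalizing Y with
  | zero => intro X _ _ _ c U; exact continuousOn_const
  | succ n ih =>
    intro X _ _ _ c U
    refine ⟨continuousOn_const, fun _ => 0, fun x _ h => ?_, continuousOn_const, ih _ _⟩
    simp [HasDirDerivAt]

theorem CnOn.clm {n : ℕ} : ∀ {X : Type u} [AddCommGroup X] [Module K X]
    [TopologicalSpace X] (L : X →L[K] Y) (U : Set X), CnOn K n L U := by
  induction n with
  | zero => intro X _ _ _ L U; exact L.continuous.continuousOn
  | succ n ih =>
    intro X _ _ _ L U
    refine ⟨L.continuous.continuousOn, L.comp (ContinuousLinearMap.snd K X X), fun x _ h => ?_,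
      (L.comp (ContinuousLinearMap.snd K X X)).continuous.continuousOn, ih _ _⟩
    refine tendsto_const_nhds.congr' ?_
    filter_upwards [self_mem_nhdsWithin] with t ht
    have ht : t ≠ 0 := ht
    simp [smul_smul, inv_mul_cancel₀ ht]

theorem CnOn.prodMk {n : ℕ} : ∀ {X : Type u} [AddCommGroup X] [Module K X]
    [TopologicalSpace X] {f : X → Y} {g : X → Z} {U : Set X},
    CnOn K n f U → CnOn K n g U → CnOn K n (fun x => (f x, g x)) U := by
  induction n with
  | zero => intro X _ _ _ f g U hf hg; exact ContinuousOn.prodMk hf hg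
  | succ n ih =>
    intro X _ _ _ f g U hf hg
    obtain ⟨h1, df, h2, h3, h4⟩ := hf
    obtain ⟨h1', dg, h2', h3', h4'⟩ := hg
    refine ⟨h1.prodMk h1', fun p => (df p, dg p), fun x hx h => ?_, h3.prodMk h3', ih h4 h4'⟩
    exact (h2 x hx h).prodMk_nhds (h2' x hx h)

theorem CnOn.comp_clm {n : ℕ} : ∀ {X : Type u} [AddCommGroup X] [Module K X]
    [TopologicalSpace X] {X' : Type w} [AddCommGroup X'] [Module K X'] [TopologicalSpace X']
    {f : X → Y} {U : Set X} (L : X' →L[K] X), CnOn K n f U →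
      CnOn K n (fun x => f (L x)) (L ⁻¹' U) := by
  induction n with
  | zero =>
    intro X _ _ _ X' _ _ _ f U L hf
    exact ContinuousOn.comp hf L.continuous.continuousOn (fun x hx => hx)
  | succ n ih =>
    intro X _ _ _ X' _ _ _ f U L hf
    obtain ⟨h1, df, h2, h3, h4⟩ := hf
    have key := ih (L.prodMap L) h4
    have hset : (L.prodMap L) ⁻¹' (U ×ˢ (univ : Set X)) = (L ⁻¹' U) ×ˢ (univ : Set X') := by
      ext p; simp
    rw [hset] at key
    refine ⟨h1.comp L.continuous.continuousOn (fun x hx => hx), _, fun x hx h => ?_,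
      key.continuousOn, key⟩
    simpa [HasDirDerivAt] using h2 (L x) hx (L h)

theorem CnOn.comp {n : ℕ} : ∀ {X : Type u} [AddCommGroup X] [Module K X]
    [TopologicalSpace X] [LocallyConvexTVS K X] {Y : Type v} [AddCommGroup Y] [Module K Y]
    [TopologicalSpace Y] [LocallyConvexTVS K Y] {f : X → Y} {g : Y → Z} {U : Set X} {V : Set Y},
    IsOpen U → IsOpen V → MapsTo f U V → CnOn K n g V → CnOn K n f U →
      CnOn K n (fun x => g (f x)) U := by
  induction n with
  | zero =>
    intro X _ _ _ _ Y _ _ _ _ f g U V _ _ hm hg hf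
    exact ContinuousOn.comp hg hf hm
  | succ n ih =>
    intro X _ _ _ _ Y _ _ _ _ f g U V hU hV hm hg hf
    have hfn := hf.of_succ
    obtain ⟨h1, df, h2, h3, h4⟩ := hf
    obtain ⟨h1', dg, h2', h3', h4'⟩ := hg
    have hU' : IsOpen (U ×ˢ (univ : Set X)) := hU.prod isOpen_univ
    have hV' : IsOpen (V ×ˢ (univ : Set Y)) := hV.prod isOpen_univ
    have hfst : CnOn K n (fun p : X × X => f p.1) (U ×ˢ univ) :=
      (hfn.comp_clm (ContinuousLinearMap.fst K X X)).mono (fun p hp => hp.1)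
    have hpair := hfst.prodMk h4
    have hm' : MapsTo (fun p : X × X => (f p.1, df p)) (U ×ˢ univ) (V ×ˢ univ) :=
      fun p hp => ⟨hm hp.1, mem_univ _⟩
    have key := ih hU' hV' hm' h4' hpair
    refine ⟨h1'.comp h1 hm, fun p => dg (f p.1, df p), fun x hx h => ?_, key.continuousOn, key⟩
    have hk := HasDirDerivAt.comp_curve hV h2' h3' (hm hx) (h2 x hx h)
    refine hk.congr' ?_
    filter_upwards [self_mem_nhdsWithin] with t ht
    have ht : t ≠ 0 := ht
    rw [smul_smul, mul_inv_cancel₀ ht, one_smul, add_sub_cancel]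

end Calculus

/-- The product of two charted spaces, modelled on the product of the model vector spaces. -/
instance prodChartedSpace' (E F M M' : Type*) [TopologicalSpace E] [TopologicalSpace F]
    [TopologicalSpace M] [TopologicalSpace M'] [ChartedSpace E M] [ChartedSpace F M'] :
    ChartedSpace (E × F) (M × M') :=
  prodChartedSpace E M F M'

/-- Smoothness on an open set `U` of a map between manifolds modelled on locally convex spaces:
`f` is continuous on `U`, and smooth on `U` in all charts. -/
def MapSmoothOn (K E F : Type*) [RCLike K] [AddCommGroup E] [Module K E] [TopologicalSpace E]
    [AddCommGroup F] [Module K F] [TopologicalSpace F] {M M' : Type*} [TopologicalSpace M]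
    [ChartedSpace E M] [TopologicalSpace M'] [ChartedSpace F M'] (f : M → M') (U : Set M) : Prop :=
  ContinuousOn f U ∧ ∀ e ∈ atlas E M, ∀ e' ∈ atlas F M', ∀ n : ℕ,
    CnOn K n (fun x => e' (f (e.symm x))) (e.target ∩ e.symm ⁻¹' (U ∩ f ⁻¹' e'.source))

/-- A Lie group modelled on the locally convex space `E`: a Hausdorff manifold with smooth chart
changes (that is, the identity is smooth with respect to any two charts), whose multiplication and
inversion are smooth. -/
class LCLieGroup (K E G : Type*) [RCLike K] [AddCommGroup E] [Module K E] [TopologicalSpace E]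
    [LocallyConvexTVS K E] [Group G] [TopologicalSpace G] [ChartedSpace E G] : Prop extends T2Space G where
  chart_smooth : MapSmoothOn K E E (id : G → G) univ
  mul_smooth : MapSmoothOn K (E × E) E (fun p : G × G => p.1 * p.2) univ
  inv_smooth : MapSmoothOn K E E (fun g : G => g⁻¹) univ

section Manifolds

variable {K : Type*} [RCLike K]
variable {E : Type*} [AddCommGroup E] [Module K E] [TopologicalSpace E] [LocallyConvexTVS K E]
variable {F : Type*} [AddCommGroup F] [Module K F] [TopologicalSpace F] [LocallyConvexTVS K F]
variable {H : Type*} [AddCommGroup H] [Module K H] [TopologicalSpace H] [LocallyConvexTVS K H]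
variable {M : Type*} [TopologicalSpace M] [ChartedSpace E M]
variable {P : Type*} [TopologicalSpace P] [ChartedSpace F P]
variable {Q : Type*} [TopologicalSpace Q] [ChartedSpace H Q]

theorem MapSmoothOn.mono {f : M → P} {U V : Set M} (hf : MapSmoothOn K E F f U) (h : V ⊆ U) :
    MapSmoothOn K E F f V :=
  ⟨hf.1.mono h, fun e he e' he' n => (hf.2 e he e' he' n).mono
    (inter_subset_inter_right _ (preimage_mono (inter_subset_inter_left _ h)))⟩

theorem MapSmoothOn.congr {f f' : M → P} {U : Set M} (hU : IsOpen U) (hff : EqOn f f' U)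
    (hf : MapSmoothOn K E F f U) : MapSmoothOn K E F f' U := by
  refine ⟨hf.1.congr hff.symm, fun e he e' he' n => ?_⟩
  have hset : U ∩ f' ⁻¹' e'.source = U ∩ f ⁻¹' e'.source := by
    ext x
    simp only [mem_inter_iff, mem_preimage]
    exact and_congr_right fun hx => by rw [hff hx]
  rw [hset]
  refine (hf.2 e he e' he' n).congr
    (e.isOpen_inter_preimage_symm (hf.1.isOpen_inter_preimage hU e'.open_source)) ?_
  intro x hx
  simp only [hff hx.2.1]

theorem MapSmoothOn.comp {f : M → P} {g : P → Q} {U : Set M} {V : Set P} (hU : IsOpen U)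
    (hV : IsOpen V) (hm : MapsTo f U V) (hg : MapSmoothOn K F H g V)
    (hf : MapSmoothOn K E F f U) : MapSmoothOn K E H (fun x => g (f x)) U := by
  refine ⟨hg.1.comp hf.1 hm, fun e he e'' he'' n => CnOn.of_locally fun x hx => ?_⟩
  set e' := chartAt F (f (e.symm x)) with he'
  have he'a : e' ∈ atlas F P := chart_mem_atlas F _
  set O : Set P := e'.source ∩ (V ∩ g ⁻¹' e''.source) with hO
  have hOo : IsOpen O := e'.open_source.inter (hg.1.isOpen_inter_preimage hV e''.open_source)
  refine ⟨e.target ∩ e.symm ⁻¹' (U ∩ f ⁻¹' O),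
    e.isOpen_inter_preimage_symm (hf.1.isOpen_inter_preimage hU hOo), ?_, ?_, ?_⟩
  · exact ⟨hx.1, hx.2.1, mem_chart_source F _, hm hx.2.1, hx.2.2⟩
  · rintro y ⟨h1, h2, h3, h4, h5⟩
    exact ⟨h1, h2, h5⟩
  · have h1 := CnOn.mono (V := e.target ∩ e.symm ⁻¹' (U ∩ f ⁻¹' O))
      (by exact fun y hy => ⟨hy.1, hy.2.1, hy.2.2.1⟩) (hf.2 e he e' he'a n)
    have h2 := hg.2 e' he'a e'' he'' n
    have hWo : IsOpen (e.target ∩ e.symm ⁻¹' (U ∩ f ⁻¹' O)) :=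
      e.isOpen_inter_preimage_symm (hf.1.isOpen_inter_preimage hU hOo)
    have h3 := CnOn.comp hWo
      (e'.isOpen_inter_preimage_symm (hg.1.isOpen_inter_preimage hV e''.open_source))
      (f := fun x => e' (f (e.symm x))) (g := fun y => e'' (g (e'.symm y))) ?_ h2 h1
    · refine h3.congr hWo fun y hy => ?_
      simp only [e'.left_inv hy.2.2.1]
    · intro y hy
      refine ⟨e'.map_source hy.2.2.1, ?_⟩
      simp only [mem_preimage, e'.left_inv hy.2.2.1]
      exact hy.2.2.2

theorem MapSmoothOn.prodMk {f : M → P} {g : M → Q} {U : Set M} (hf : MapSmoothOn K E F f U)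
    (hg : MapSmoothOn K E H g U) : MapSmoothOn K E (F × H) (fun x => (f x, g x)) U := by
  refine ⟨hf.1.prodMk hg.1, ?_⟩
  rintro e he e' ⟨e₁, he₁, e₂, he₂, rfl⟩ n
  exact CnOn.prodMk
    (CnOn.mono (by exact fun x hx => ⟨hx.1, hx.2.1, hx.2.2.1⟩) (hf.2 e he e₁ he₁ n))
    (CnOn.mono (by exact fun x hx => ⟨hx.1, hx.2.1, hx.2.2.2⟩) (hg.2 e he e₂ he₂ n))

theorem MapSmoothOn.const (c : P) (U : Set M) : MapSmoothOn K E F (fun _ : M => c) U :=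
  ⟨continuousOn_const, fun _ _ _ _ _ => CnOn.const _ _⟩

theorem MapSmoothOn.fst (hP : MapSmoothOn K F F (id : P → P) univ) :
    MapSmoothOn K (F × H) F (Prod.fst : P × Q → P) univ := by
  refine ⟨continuousOn_fst, ?_⟩
  rintro e ⟨e₁, he₁, e₂, he₂, rfl⟩ e' he' n
  exact CnOn.mono (by exact fun x hx => ⟨hx.1.1, mem_univ _, hx.2.2⟩)
    ((hP.2 e₁ he₁ e' he' n).comp_clm (ContinuousLinearMap.fst K F H))

theorem MapSmoothOn.snd (hQ : MapSmoothOn K H H (id : Q → Q) univ) :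
    MapSmoothOn K (F × H) H (Prod.snd : P × Q → Q) univ := by
  refine ⟨continuousOn_snd, ?_⟩
  rintro e ⟨e₁, he₁, e₂, he₂, rfl⟩ e' he' n
  exact CnOn.mono (by exact fun x hx => ⟨hx.1.2, mem_univ _, hx.2.2⟩)
    ((hQ.2 e₂ he₂ e' he' n).comp_clm (ContinuousLinearMap.snd K F H))

end Manifolds

section Groups

variable {K : Type*} [RCLike K]
variable {E : Type*} [AddCommGroup E] [Module K E] [TopologicalSpace E] [LocallyConvexTVS K E]
variable {F : Type*} [AddCommGroup F] [Module K F] [TopologicalSpace F] [LocallyConvexTVS K F]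
variable {M : Type*} [TopologicalSpace M] [ChartedSpace E M]
variable {P : Type*} [TopologicalSpace P] [ChartedSpace F P]

theorem MapSmoothOn.mul [Group P] [LCLieGroup K F P] {f g : M → P} {U : Set M} (hU : IsOpen U)
    (hf : MapSmoothOn K E F f U) (hg : MapSmoothOn K E F g U) :
    MapSmoothOn K E F (fun x => f x * g x) U :=
  MapSmoothOn.comp (g := fun p : P × P => p.1 * p.2) hU isOpen_univ (mapsTo_univ _ _)
    LCLieGroup.mul_smooth (hf.prodMk hg)

theorem MapSmoothOn.inv [Group P] [LCLieGroup K F P] {f : M → P} {U : Set M} (hU : IsOpen U)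
    (hf : MapSmoothOn K E F f U) : MapSmoothOn K E F (fun x => (f x)⁻¹) U :=
  MapSmoothOn.comp (g := fun p : P => p⁻¹) hU isOpen_univ (mapsTo_univ _ _)
    LCLieGroup.inv_smooth hf

end Groups

/-- The group `Aut(G)` of Lie group automorphisms: group automorphisms that are smooth with smooth inverse. -/
def LieAut (K E G : Type*) [RCLike K] [AddCommGroup E] [Module K E] [TopologicalSpace E]
    [LocallyConvexTVS K E] [Group G] [TopologicalSpace G] [ChartedSpace E G] [LCLieGroup K E G] :
    Subgroup (MulAut G) where
  carrier := {φ | MapSmoothOn K E E φ univ ∧ MapSmoothOn K E E φ.symm univ}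
  one_mem' := ⟨LCLieGroup.chart_smooth, LCLieGroup.chart_smooth⟩
  mul_mem' {φ ψ} hφ hψ :=
    ⟨MapSmoothOn.comp (g := φ) (f := ψ) isOpen_univ isOpen_univ (mapsTo_univ _ _) hφ.1 hψ.1,
      MapSmoothOn.comp (g := ψ.symm) (f := φ.symm) isOpen_univ isOpen_univ (mapsTo_univ _ _)
        hψ.2 hφ.2⟩
  inv_mem' {_} hφ := ⟨hφ.2, hφ.1⟩

/-- `f` is smooth on some open neighbourhood of the identity. -/
def SmoothNearOne (K E F : Type*) [RCLike K] [AddCommGroup E] [Module K E] [TopologicalSpace E]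
    [AddCommGroup F] [Module K F] [TopologicalSpace F] {M P : Type*} [One M] [TopologicalSpace M]
    [ChartedSpace E M] [TopologicalSpace P] [ChartedSpace F P] (f : M → P) : Prop :=
  ∃ U : Set M, IsOpen U ∧ 1 ∈ U ∧ MapSmoothOn K E F f U

section NearOne

variable {K : Type*} [RCLike K]
variable {E : Type*} [AddCommGroup E] [Module K E] [TopologicalSpace E] [LocallyConvexTVS K E]
variable {F : Type*} [AddCommGroup F] [Module K F] [TopologicalSpace F] [LocallyConvexTVS K F]
variable {H : Type*} [AddCommGroup H] [Module K H] [TopologicalSpace H] [LocallyConvexTVS K H]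
variable {M : Type*} [TopologicalSpace M] [ChartedSpace E M] [One M]
variable {P : Type*} [TopologicalSpace P] [ChartedSpace F P]
variable {Q : Type*} [TopologicalSpace Q] [ChartedSpace H Q]

theorem SmoothNearOne.const (c : P) : SmoothNearOne K E F (fun _ : M => c) :=
  ⟨univ, isOpen_univ, mem_univ _, MapSmoothOn.const _ _⟩

theorem SmoothNearOne.mul [Group P] [LCLieGroup K F P] {f g : M → P}
    (hf : SmoothNearOne K E F f) (hg : SmoothNearOne K E F g) :
    SmoothNearOne K E F (fun x => f x * g x) := by
  obtain ⟨U, hU, h1, hf⟩ := hf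
  obtain ⟨V, hV, h2, hg⟩ := hg
  exact ⟨U ∩ V, hU.inter hV, ⟨h1, h2⟩, MapSmoothOn.mul (hU.inter hV)
    (hf.mono inter_subset_left) (hg.mono inter_subset_right)⟩

theorem SmoothNearOne.inv [Group P] [LCLieGroup K F P] {f : M → P}
    (hf : SmoothNearOne K E F f) : SmoothNearOne K E F (fun x => (f x)⁻¹) := by
  obtain ⟨U, hU, h1, hf⟩ := hf
  exact ⟨U, hU, h1, MapSmoothOn.inv hU hf⟩

theorem SmoothNearOne.comp_left {f : M → P} {g : P → Q} (hg : MapSmoothOn K F H g univ)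
    (hf : SmoothNearOne K E F f) : SmoothNearOne K E H (fun x => g (f x)) := by
  obtain ⟨U, hU, h1, hf⟩ := hf
  exact ⟨U, hU, h1, MapSmoothOn.comp hU isOpen_univ (mapsTo_univ _ _) hg hf⟩

theorem SmoothNearOne.comp_right [One P] {f : P → Q} {g : M → P}
    (hf : SmoothNearOne K F H f) (hg : MapSmoothOn K E F g univ) (h1 : g 1 = 1) :
    SmoothNearOne K E H (fun x => f (g x)) := by
  obtain ⟨U, hU, hU1, hf⟩ := hf
  have ho : IsOpen (g ⁻¹' U) := by
    simpa using hg.1.isOpen_inter_preimage isOpen_univ hU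
  exact ⟨g ⁻¹' U, ho, by simpa [h1] using hU1,
    MapSmoothOn.comp ho hU (fun x hx => hx) hf (hg.mono (subset_univ _))⟩

end NearOne

section Cochains

variable (K EG EN : Type*) [RCLike K]
  [AddCommGroup EG] [Module K EG] [TopologicalSpace EG] [LocallyConvexTVS K EG]
  [AddCommGroup EN] [Module K EN] [TopologicalSpace EN] [LocallyConvexTVS K EN]
  {G N : Type*} [Group G] [TopologicalSpace G] [ChartedSpace EG G] [LCLieGroup K EG G]
  [Group N] [TopologicalSpace N] [ChartedSpace EN N] [LCLieGroup K EN N]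

/-- `C¹_s(G, N)`: normalized maps `G → N` that are smooth in an identity neighbourhood. -/
def IsCochain₁ (f : G → N) : Prop :=
  f 1 = 1 ∧ SmoothNearOne K EG EN f

/-- `C²_s(G, N)`: normalized maps `G × G → N` that are smooth in an identity neighbourhood. -/
def IsCochain₂ (ω : G × G → N) : Prop :=
  (∀ g g' : G, (g = 1 ∨ g' = 1) → ω (g, g') = 1) ∧ SmoothNearOne K (EG × EG) EN ω

/-- `C²_ss(G, N)`: those `ω ∈ C²_s(G, N)` for which all maps `x ↦ ω(g, x) ω(g x g⁻¹, g)⁻¹` are smooth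
in an identity neighbourhood of `G`. -/
def IsCochain₂ss (ω : G × G → N) : Prop :=
  IsCochain₂ K EG EN ω ∧
    ∀ g : G, SmoothNearOne K EG EN (fun x : G => ω (g, x) * (ω (g * x * g⁻¹, g))⁻¹)

variable (G N) in
/-- A smooth outer action of `G` on `N`: a map `S : G → Aut(N)` with `S(1) = id`, for which
`(g, n) ↦ S(g)(n)` is smooth on `U × N` for an open identity neighbourhood `U`, and such that
`S(g) S(g') S(g g')⁻¹` is conjugation by `ω(g, g')` for some `ω ∈ C²_s(G, N)`. -/
structure SmoothOuterAction where
  toFun : G → MulAut N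
  mem_lieAut : ∀ g, toFun g ∈ LieAut K EN N
  toFun_one : toFun 1 = 1
  smooth : ∃ U : Set G, IsOpen U ∧ 1 ∈ U ∧
    MapSmoothOn K (EG × EN) EN (fun p : G × N => toFun p.1 p.2) (U ×ˢ univ)
  outer : ∃ ω : G × G → N, IsCochain₂ K EG EN ω ∧
    ∀ g g', toFun g * toFun g' * (toFun (g * g'))⁻¹ = MulAut.conj (ω (g, g'))

/-- `S ∼ S'`: there is `h ∈ C¹_s(G, N)` with `S' = (C_N ∘ h) · S`. -/
def KernelEquiv (S S' : G → MulAut N) : Prop :=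
  ∃ h : G → N, IsCochain₁ K EG EN h ∧ ∀ g, S' g = MulAut.conj (h g) * S g

end Cochains

section Cohomology

variable {K EG EN : Type*} [RCLike K]
  [AddCommGroup EG] [Module K EG] [TopologicalSpace EG] [LocallyConvexTVS K EG]
  [AddCommGroup EN] [Module K EN] [TopologicalSpace EN] [LocallyConvexTVS K EN]
  {G N : Type*} [Group G] [TopologicalSpace G] [ChartedSpace EG G] [LCLieGroup K EG G]
  [Group N] [TopologicalSpace N] [ChartedSpace EN N] [LCLieGroup K EN N]

variable (K EG EN G N) in
/-- `C¹_s(G, Z(N))`; smoothness is that of maps into `N`. -/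
def CentralC₁ : Subgroup (G → Subgroup.center N) where
  carrier := {f | IsCochain₁ K EG EN (fun g => (f g : N))}
  one_mem' := ⟨rfl, SmoothNearOne.const 1⟩
  mul_mem' {f f'} hf hf' := ⟨by simp [hf.1, hf'.1], hf.2.mul hf'.2⟩
  inv_mem' {f} hf := ⟨by simp [hf.1], hf.2.inv⟩

variable (K EG EN G N) in
/-- `C²_ss(G, Z(N))`; smoothness is that of maps into `N`. -/
def CentralC₂ss : Subgroup (G × G → Subgroup.center N) where
  carrier := {f | IsCochain₂ss K EG EN (fun x => (f x : N))}
  one_mem' := ⟨⟨fun _ _ _ => rfl, SmoothNearOne.const 1⟩, fun g => by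
    simpa using SmoothNearOne.const (1 : N)⟩
  mul_mem' {f f'} hf hf' := by
    refine ⟨⟨fun g g' h => ?_, hf.1.2.mul hf'.1.2⟩, fun g => ?_⟩
    · simpa [hf'.1.1 g g' h] using hf.1.1 g g' h
    · have h := (hf.2 g).mul (hf'.2 g)
      convert h using 2 with x
      have aux : ∀ a a' b b' : N, (∀ y, y * b = b * y) →
          a * a' * (b * b')⁻¹ = a * b⁻¹ * (a' * b'⁻¹) := by
        intro a a' b b' hb
        have : b⁻¹ * (a' * b'⁻¹) = a' * b'⁻¹ * b⁻¹ := (Commute.inv_left (hb _).symm).eq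
        rw [mul_assoc a b⁻¹, this, mul_inv_rev]
        simp only [mul_assoc]
      exact aux _ _ _ _ (Subgroup.mem_center_iff.1 (f (g * x * g⁻¹, g)).2)
  inv_mem' {f} hf := by
    refine ⟨⟨fun g g' h => ?_, hf.1.2.inv⟩, fun g => ?_⟩
    · simpa using hf.1.1 g g' h
    · have h := (hf.2 g).inv
      convert h using 2 with x
      have hc := Subgroup.mem_center_iff.1 (f (g * x * g⁻¹, g)).2
      simp only [Pi.inv_apply, InvMemClass.coe_inv, mul_inv_rev, inv_inv]
      exact hc _

namespace SmoothOuterAction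

variable (S : SmoothOuterAction K EG EN G N)

/-- The automorphism `z ↦ S(g)(z)` of the centre `Z(N)`. -/
def centerAct (g : G) : Subgroup.center N ≃* Subgroup.center N :=
  Subgroup.centerCongr (S.toFun g)

/-- `(d_S f)(g, g') = S(g)(f(g')) f(g g')⁻¹ f(g)`, in multiplicative notation. -/
def d₁ : (G → Subgroup.center N) →* (G × G → Subgroup.center N) where
  toFun f := fun x => S.centerAct x.1 (f x.2) * (f (x.1 * x.2))⁻¹ * f x.1
  map_one' := by ext x; simp
  map_mul' f f' := by
    ext1 x
    simp only [Pi.mul_apply, map_mul, mul_inv]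
    ac_rfl

/-- `(d_S f)(g, g', g'') = S(g)(f(g', g'')) f(g g', g'')⁻¹ f(g, g' g'') f(g, g')⁻¹`, in multiplicative
notation. -/
def d₂ : (G × G → Subgroup.center N) →* (G × G × G → Subgroup.center N) where
  toFun f := fun x => S.centerAct x.1 (f (x.2.1, x.2.2)) * (f (x.1 * x.2.1, x.2.2))⁻¹ *
    f (x.1, x.2.1 * x.2.2) * (f (x.1, x.2.1))⁻¹
  map_one' := by ext x; simp
  map_mul' f f' := by
    ext1 x
    simp only [Pi.mul_apply, map_mul, mul_inv]
    ac_rfl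

/-- `Z¹_s(G, Z(N))_S`. -/
def Z₁ : Subgroup (G → Subgroup.center N) := CentralC₁ K EG EN G N ⊓ S.d₁.ker

/-- `Z²_ss(G, Z(N))_S`. -/
def Z₂ss : Subgroup (G × G → Subgroup.center N) := CentralC₂ss K EG EN G N ⊓ S.d₂.ker

/-- `B²_s(G, Z(N))_S = d_S(C¹_s(G, Z(N)))`. -/
def B₂ : Subgroup (G × G → Subgroup.center N) := (CentralC₁ K EG EN G N).map S.d₁

/-- `H²_ss(G, Z(N))_S = Z²_ss(G, Z(N))_S / B²_s(G, Z(N))_S`, written multiplicatively. -/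
abbrev H₂ss : Type _ := S.Z₂ss ⧸ S.B₂.subgroupOf S.Z₂ss

end SmoothOuterAction

/-- `(φ, ψ).S = c_φ ∘ S ∘ ψ⁻¹`. -/
def pairAct (p : LieAut K EN N × LieAut K EG G) (S : G → MulAut N) : G → MulAut N :=
  fun g => (p.1 : MulAut N) * S ((p.2 : MulAut G)⁻¹ g) * (p.1 : MulAut N)⁻¹

theorem IsCochain₁.pair {h : G → N} (hh : IsCochain₁ K EG EN h)
    (p : LieAut K EN N × LieAut K EG G) :
    IsCochain₁ K EG EN (fun g => (p.1 : MulAut N) (h ((p.2 : MulAut G)⁻¹ g))) :=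
  ⟨by simp [hh.1], (hh.2.comp_right (p.2⁻¹).2.1 (map_one _)).comp_left p.1.2.1⟩

theorem conj_apply_aut (φ : MulAut N) (n : N) :
    MulAut.conj (φ n) = φ * MulAut.conj n * φ⁻¹ := by
  ext m; simp

/-- `Comp(S)`: the pairs `(φ, ψ) ∈ Aut(N) × Aut(G)` with `(φ, ψ).S ∼ S`. -/
def SmoothOuterAction.Comp (S : SmoothOuterAction K EG EN G N) :
    Subgroup (LieAut K EN N × LieAut K EG G) where
  carrier := {p | KernelEquiv K EG EN (pairAct p S.toFun) S.toFun}
  one_mem' := ⟨fun _ => 1, ⟨rfl, SmoothNearOne.const 1⟩, fun g => by simp [pairAct]⟩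
  mul_mem' := by
    rintro p p' ⟨h, hh, e⟩ ⟨h', hh', e'⟩
    refine ⟨fun g => h g * (p.1 : MulAut N) (h' ((p.2 : MulAut G)⁻¹ g)),
      ⟨by simp [hh.1, hh'.1], hh.2.mul (hh'.pair p).2⟩, fun g => ?_⟩
    rw [e, map_mul, conj_apply_aut]
    simp only [pairAct]
    rw [e' ((p.2 : MulAut G)⁻¹ g)]
    simp only [pairAct, Prod.fst_mul, Prod.snd_mul, Subgroup.coe_mul, mul_inv_rev, MulAut.mul_apply]
    group
  inv_mem' := by
    rintro p ⟨h, hh, e⟩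
    refine ⟨fun g => ((p⁻¹).1 : MulAut N) (h (((p⁻¹).2 : MulAut G)⁻¹ g))⁻¹,
      ⟨by simp [hh.1], ?_⟩, fun g => ?_⟩
    · have := (hh.pair p⁻¹).2.inv
      simpa using this
    · have := e ((p.2 : MulAut G) g)
      show _ = MulAut.conj (((p⁻¹).1 : MulAut N) (h (((p⁻¹).2 : MulAut G)⁻¹ g))⁻¹) * _
      rw [map_inv, map_inv, conj_apply_aut]
      simp only [pairAct, Prod.fst_inv, Prod.snd_inv, Subgroup.coe_inv, inv_inv] at this ⊢
      rw [this]
      simp [mul_assoc]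

theorem SmoothOuterAction.comp_center {S : SmoothOuterAction K EG EN G N}
    {p : LieAut K EN N × LieAut K EG G} (hp : p ∈ S.Comp) (g : G) (z : Subgroup.center N) :
    Subgroup.centerCongr (p.1 : MulAut N) (S.centerAct g z) =
      S.centerAct ((p.2 : MulAut G) g) (Subgroup.centerCongr (p.1 : MulAut N) z) := by
  obtain ⟨h, -, e⟩ := hp
  have := congrArg (fun f : MulAut N => f ((p.1 : MulAut N) z)) (e ((p.2 : MulAut G) g))
  apply Subtype.ext
  have hz : (p.1 : MulAut N) (S.toFun g z) ∈ Subgroup.center N :=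
    (Subgroup.centerCongr (p.1 : MulAut N) (S.centerAct g z)).2
  have hc := Subgroup.mem_center_iff.1 hz (h ((p.2 : MulAut G) g))
  simp only [pairAct, MulAut.mul_apply, MulAut.inv_apply_self, MulAut.conj_apply] at this
  rw [hc, mul_inv_cancel_right] at this
  exact this.symm

/-- `(φ, ψ).f = φ ∘ f ∘ ψ⁻¹` for `f : G → Z(N)`. -/
def centralPull₁ (p : LieAut K EN N × LieAut K EG G) :
    (G → Subgroup.center N) →* (G → Subgroup.center N) where
  toFun f := fun x => Subgroup.centerCongr (p.1 : MulAut N) (f ((p.2 : MulAut G)⁻¹ x))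
  map_one' := by ext x; simp
  map_mul' f f' := by ext1 x; simp

/-- `(φ, ψ).f = φ ∘ f ∘ (ψ⁻¹ × ψ⁻¹)` for `f : G × G → Z(N)`. -/
def centralPull₂ (p : LieAut K EN N × LieAut K EG G) :
    (G × G → Subgroup.center N) →* (G × G → Subgroup.center N) where
  toFun f := fun x => Subgroup.centerCongr (p.1 : MulAut N)
    (f ((p.2 : MulAut G)⁻¹ x.1, (p.2 : MulAut G)⁻¹ x.2))
  map_one' := by ext x; simp
  map_mul' f f' := by ext1 x; simp

theorem SmoothOuterAction.d₁_pull {S : SmoothOuterAction K EG EN G N}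
    {p : LieAut K EN N × LieAut K EG G} (hp : p ∈ S.Comp) (f : G → Subgroup.center N) :
    S.d₁ (centralPull₁ p f) = centralPull₂ p (S.d₁ f) := by
  ext1 x
  simp [d₁, centralPull₁, centralPull₂, S.comp_center hp]

theorem SmoothOuterAction.pull_mem_Z₂ss {S : SmoothOuterAction K EG EN G N}
    {p : LieAut K EN N × LieAut K EG G} (hp : p ∈ S.Comp) {f : G × G → Subgroup.center N}
    (hf : f ∈ S.Z₂ss) : centralPull₂ p f ∈ S.Z₂ss := by
  obtain ⟨⟨⟨hn, hs⟩, hss⟩, hd⟩ := hf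
  refine ⟨⟨⟨fun g g' h => ?_, ?_⟩, fun g => ?_⟩, ?_⟩
  · have := hn ((p.2 : MulAut G)⁻¹ g) ((p.2 : MulAut G)⁻¹ g') (by simpa using h)
    have h1 : f ((p.2 : MulAut G)⁻¹ g, (p.2 : MulAut G)⁻¹ g') = 1 := Subtype.ext this
    show ((Subgroup.centerCongr (p.1 : MulAut N)
      (f ((p.2 : MulAut G)⁻¹ g, (p.2 : MulAut G)⁻¹ g')) : Subgroup.center N) : N) = 1
    rw [h1, map_one, OneMemClass.coe_one]
  · have hpsi := (p.2⁻¹).2.1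
    have hm : MapSmoothOn K (EG × EG) (EG × EG) (fun x : G × G =>
        ((p.2 : MulAut G)⁻¹ x.1, (p.2 : MulAut G)⁻¹ x.2)) univ :=
      MapSmoothOn.prodMk
        (MapSmoothOn.comp isOpen_univ isOpen_univ (mapsTo_univ _ _) hpsi
          (MapSmoothOn.fst LCLieGroup.chart_smooth))
        (MapSmoothOn.comp isOpen_univ isOpen_univ (mapsTo_univ _ _) hpsi
          (MapSmoothOn.snd LCLieGroup.chart_smooth))
    exact SmoothNearOne.comp_left (g := (p.1 : MulAut N)) p.1.2.1 (hs.comp_right hm (by simp))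
  · have h := SmoothNearOne.comp_left (g := (p.1 : MulAut N)) p.1.2.1
      ((hss ((p.2 : MulAut G)⁻¹ g)).comp_right (g := ((p.2 : MulAut G)⁻¹ : MulAut G)) (p.2⁻¹).2.1
        (_root_.map_one _))
    convert h using 2 with x
    simp [centralPull₂, Subgroup.centerCongr, Submonoid.centerCongr, Subsemigroup.centerCongr]
    rfl
  · have hd : S.d₂ f = 1 := hd
    show S.d₂ (centralPull₂ p f) = 1
    ext1 x
    have := congrArg (Subgroup.centerCongr (p.1 : MulAut N)) (congrFun hd
      ((p.2 : MulAut G)⁻¹ x.1, (p.2 : MulAut G)⁻¹ x.2.1, (p.2 : MulAut G)⁻¹ x.2.2))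
    simpa [d₂, centralPull₂, S.comp_center hp] using this

namespace SmoothOuterAction

variable (S : SmoothOuterAction K EG EN G N)

/-- The action `(φ, ψ).[β] = [(φ, ψ).β]` of `Comp(S)` on `H²_ss(G, Z(N))_S`. -/
def compAct (p : S.Comp) : S.H₂ss →* S.H₂ss :=
  QuotientGroup.map _ _
    (((centralPull₂ (p : LieAut K EN N × LieAut K EG G)).comp S.Z₂ss.subtype).codRestrict S.Z₂ss
      (fun f => S.pull_mem_Z₂ss p.2 f.2)) (by
    rintro ⟨f, hf⟩ ⟨a, ha, hd⟩
    exact ⟨centralPull₁ (p : LieAut K EN N × LieAut K EG G) a,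
      IsCochain₁.pair (h := fun g => (a g : N)) ha _,
      (S.d₁_pull p.2 a).trans (congrArg _ hd)⟩)

instance : MulDistribMulAction S.Comp S.H₂ss where
  smul p c := S.compAct p c
  one_smul c := by
    obtain ⟨f, rfl⟩ := QuotientGroup.mk_surjective c
    rfl
  mul_smul p p' c := by
    obtain ⟨f, rfl⟩ := QuotientGroup.mk_surjective c
    rfl
  smul_one p := map_one (S.compAct p)
  smul_mul p c c' := map_mul (S.compAct p) c c'

end SmoothOuterAction

end Cohomology

/-- A Lie group extension `1 → N → H → G → 1` (with `H` in the role of `Ĝ`): a short exact sequence of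
smooth homomorphisms that makes `H` a smooth principal `N`-bundle over `G`. The last field says that
over an open neighbourhood `U` of each point there is a smooth section `s` for which the bijection
`U × N → q⁻¹(U)`, `(x, n) ↦ s(x) ι(n)` has a smooth inverse `y ↦ (q y, r y)`. -/
structure LieGroupExtension (K EN EH EG N H G : Type*) [RCLike K]
    [AddCommGroup EN] [Module K EN] [TopologicalSpace EN] [LocallyConvexTVS K EN]
    [AddCommGroup EH] [Module K EH] [TopologicalSpace EH] [LocallyConvexTVS K EH]
    [AddCommGroup EG] [Module K EG] [TopologicalSpace EG] [LocallyConvexTVS K EG]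
    [Group N] [TopologicalSpace N] [ChartedSpace EN N] [LCLieGroup K EN N]
    [Group H] [TopologicalSpace H] [ChartedSpace EH H] [LCLieGroup K EH H]
    [Group G] [TopologicalSpace G] [ChartedSpace EG G] [LCLieGroup K EG G] where
  ι : N →* H
  q : H →* G
  ι_injective : Function.Injective ι
  q_surjective : Function.Surjective q
  range_eq_ker : ι.range = q.ker
  ι_smooth : MapSmoothOn K EN EH ι univ
  q_smooth : MapSmoothOn K EH EG q univ
  locally_trivial : ∀ g : G, ∃ U : Set G, IsOpen U ∧ g ∈ U ∧ ∃ (s : G → H) (r : H → N),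
    MapSmoothOn K EG EH s U ∧ MapSmoothOn K EH EN r (q ⁻¹' U) ∧ (∀ x ∈ U, q (s x) = x) ∧
      ∀ y ∈ q ⁻¹' U, y = s (q y) * ι (r y)

namespace LieGroupExtension

variable {K EN EH EG N H G : Type*} [RCLike K]
  [AddCommGroup EN] [Module K EN] [TopologicalSpace EN] [LocallyConvexTVS K EN]
  [AddCommGroup EH] [Module K EH] [TopologicalSpace EH] [LocallyConvexTVS K EH]
  [AddCommGroup EG] [Module K EG] [TopologicalSpace EG] [LocallyConvexTVS K EG]
  [Group N] [TopologicalSpace N] [ChartedSpace EN N] [LCLieGroup K EN N]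
  [Group H] [TopologicalSpace H] [ChartedSpace EH H] [LCLieGroup K EH H]
  [Group G] [TopologicalSpace G] [ChartedSpace EG G] [LCLieGroup K EG G]

/-- The extension `(φ, ψ).X`, with inclusion `ι ∘ φ⁻¹` and projection `ψ ∘ q`. -/
def twist (X : LieGroupExtension K EN EH EG N H G) (p : LieAut K EN N × LieAut K EG G) :
    LieGroupExtension K EN EH EG N H G where
  ι := X.ι.comp ((p.1 : MulAut N)⁻¹ : MulAut N).toMonoidHom
  q := (p.2 : MulAut G).toMonoidHom.comp X.q
  ι_injective := X.ι_injective.comp (MulEquiv.injective _)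
  q_surjective := (MulEquiv.surjective (p.2 : MulAut G)).comp X.q_surjective
  range_eq_ker := by
    ext x
    have h := SetLike.ext_iff.1 X.range_eq_ker x
    simp only [MonoidHom.mem_range, MonoidHom.mem_ker] at h ⊢
    constructor
    · rintro ⟨n, rfl⟩
      have := (SetLike.ext_iff.1 X.range_eq_ker (X.ι ((p.1 : MulAut N)⁻¹ n))).1 ⟨_, rfl⟩
      rw [MonoidHom.mem_ker] at this
      simpa using this
    · intro hx
      have hx' : X.q x = 1 := by simpa using hx
      obtain ⟨n, rfl⟩ := h.2 hx'
      exact ⟨(p.1 : MulAut N) n, by simp⟩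
  ι_smooth := MapSmoothOn.comp (g := X.ι) (f := ((p.1 : MulAut N)⁻¹ : MulAut N)) isOpen_univ isOpen_univ (mapsTo_univ _ _) X.ι_smooth (p.1⁻¹).2.1
  q_smooth := MapSmoothOn.comp (g := (p.2 : MulAut G)) (f := X.q) isOpen_univ isOpen_univ (mapsTo_univ _ _) p.2.2.1 X.q_smooth
  locally_trivial g := by
    obtain ⟨U, hU, hg, s, r, hs, hr, h1, h2⟩ := X.locally_trivial ((p.2 : MulAut G)⁻¹ g)
    have hpsi := (p.2⁻¹).2.1
    have hU' : IsOpen (((p.2 : MulAut G)⁻¹ : MulAut G) ⁻¹' U) := by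
      simpa using hpsi.1.isOpen_inter_preimage isOpen_univ hU
    have hqU : IsOpen (X.q ⁻¹' U) := by
      simpa using X.q_smooth.1.isOpen_inter_preimage isOpen_univ hU
    have hset : ((p.2 : MulAut G).toMonoidHom.comp X.q) ⁻¹' (((p.2 : MulAut G)⁻¹ : MulAut G) ⁻¹' U)
        = X.q ⁻¹' U := by
      ext y; simp
    refine ⟨_, hU', hg, fun x => s ((p.2 : MulAut G)⁻¹ x), fun y => (p.1 : MulAut N) (r y),
      MapSmoothOn.comp hU' hU (fun x hx => hx) hs (hpsi.mono (subset_univ _)), ?_, ?_, ?_⟩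
    · rw [hset]
      exact MapSmoothOn.comp hqU isOpen_univ (mapsTo_univ _ _) p.1.2.1 hr
    · intro x hx
      show (p.2 : MulAut G) (X.q (s ((p.2 : MulAut G)⁻¹ x))) = x
      rw [h1 _ hx, MulAut.apply_inv_self]
    · intro y hy
      rw [hset] at hy
      simpa using h2 y hy

/-- `(S, ω)` is the factor system `(C_N ∘ σ, δ_σ)` of a normalized locally smooth section `σ` of `q`.
In other words, the map `(n, g) ↦ ι(n) σ(g)` is an equivalence of extensions from
`N ×_(S,ω) G`, the set `N × G` with the product `(n, g)(n', g') = (n S(g)(n') ω(g, g'), g g')`, onto `X`. -/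
def HasFactorSystem (X : LieGroupExtension K EN EH EG N H G) (S : G → MulAut N)
    (ω : G × G → N) : Prop :=
  ∃ σ : G → H, IsCochain₁ K EG EH σ ∧ (∀ g, X.q (σ g) = g) ∧
    (∀ g n, X.ι (S g n) = σ g * X.ι n * (σ g)⁻¹) ∧
    ∀ g g', X.ι (ω (g, g')) = σ g * σ g' * (σ (g * g'))⁻¹

/-- The extension `X` corresponds to the smooth `G`-kernel `[S]`: some (equivalently, every) normalized
locally smooth section induces an outer action equivalent to `S`. -/
def HasKernel (X : LieGroupExtension K EN EH EG N H G) (S : SmoothOuterAction K EG EN G N) :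
    Prop :=
  ∃ (S' : G → MulAut N) (ω' : G × G → N), X.HasFactorSystem S' ω' ∧
    KernelEquiv K EG EN S.toFun S'

/-- `[X'] = c.[X]` for the action of `H²_ss(G, Z(N))_S` on the set `Ext(G, N)_[S]` of equivalence classes of
extensions, `[β].[N ×_(S,ω) G] = [N ×_(S,β·ω) G]`. -/
def IsClassShift {EH' H' : Type*}
    [AddCommGroup EH'] [Module K EH'] [TopologicalSpace EH'] [LocallyConvexTVS K EH']
    [Group H'] [TopologicalSpace H'] [ChartedSpace EH' H'] [LCLieGroup K EH' H']
    (S : SmoothOuterAction K EG EN G N) (c : S.H₂ss) (X : LieGroupExtension K EN EH EG N H G)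
    (X' : LieGroupExtension K EN EH' EG N H' G) : Prop :=
  ∃ (β : S.Z₂ss) (ω : G × G → N), (β : S.H₂ss) = c ∧ X.HasFactorSystem S.toFun ω ∧
    X'.HasFactorSystem S.toFun (fun x => ((β : G × G → Subgroup.center N) x : N) * ω x)

/-- The group `Aut(Ĝ, N)` of Lie group automorphisms of `Ĝ = H` that map (the image of) `N` onto itself. -/
def Aut (X : LieGroupExtension K EN EH EG N H G) : Subgroup (MulAut H) where
  carrier := {ν | ν ∈ LieAut K EH H ∧ ν '' range X.ι = range X.ι}
  one_mem' := ⟨one_mem _, by simp⟩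
  mul_mem' {ν ν'} h h' := ⟨mul_mem h.1 h'.1, by
    rw [MulAut.coe_mul, image_comp, h'.2, h.2]⟩
  inv_mem' {ν} h := ⟨inv_mem h.1, by
    nth_rewrite 1 [← h.2]
    rw [← image_comp, ← MulAut.coe_mul, inv_mul_cancel]
    simp⟩

end LieGroupExtension

/-!
Let `σ` be a normalized locally smooth section of `q` whose factor system is `(S, ω)`. Every other
such section is `ι(h) σ` with `h ∈ C¹_s(G, N)`, and its factor system is obtained from `(S, ω)` by
an explicit formula. When `h` is central, `S` does not change and `ω` is multiplied by `d_S h`. This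
gives everything:

* two extensions with kernel `[S]` have factor systems `(S, ω)` and `(S, β ω)` with `β` a central
  cocycle that is unique up to `d_S`-coboundaries, so `H²_ss` acts simply transitively and `I`
  exists;
* `ν ∈ Aut(Ĝ, N)` induces `p = (φ, ψ)` exactly when `ν` is an equivalence from `p.Ĝ` to `Ĝ`, hence
  `p` is in the image of `Φ` if and only if `p.[Ĝ] = [Ĝ]`;
* an equivalence from `Ĝ` to itself maps `σ` to a section with the same factor system, that is, to
  `ι(f) σ` with `f` central and `d_S f = 1`, so the kernel of `Φ` is `Z¹_s`.
-/

section Smoothness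

variable {K : Type*} [RCLike K]
  {E : Type*} [AddCommGroup E] [Module K E] [TopologicalSpace E]
  {F : Type*} [AddCommGroup F] [Module K F] [TopologicalSpace F]
  {M : Type*} [TopologicalSpace M] [ChartedSpace E M]
  {P : Type*} [TopologicalSpace P] [ChartedSpace F P]

theorem MapSmoothOn.continuous {f : M → P} (hf : MapSmoothOn K E F f univ) : Continuous f :=
  continuousOn_univ.1 hf.1

theorem MapSmoothOn.smoothNearOne [One M] {f : M → P} (hf : MapSmoothOn K E F f univ) :
    SmoothNearOne K E F f :=
  ⟨univ, isOpen_univ, mem_univ _, hf⟩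

variable [LocallyConvexTVS K E] [LocallyConvexTVS K F]

theorem MapSmoothOn.comp_univ {F' : Type*} [AddCommGroup F'] [Module K F'] [TopologicalSpace F']
    [LocallyConvexTVS K F'] {Q : Type*} [TopologicalSpace Q] [ChartedSpace F' Q] {g : P → Q}
    {f : M → P} (hg : MapSmoothOn K F F' g univ) (hf : MapSmoothOn K E F f univ) :
    MapSmoothOn K E F' (fun x => g (f x)) univ :=
  MapSmoothOn.comp isOpen_univ isOpen_univ (mapsTo_univ _ _) hg hf

theorem MapSmoothOn.of_locally {f : M → P} {U : Set M}
    (h : ∀ x ∈ U, ∃ V, IsOpen V ∧ x ∈ V ∧ V ⊆ U ∧ MapSmoothOn K E F f V) :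
    MapSmoothOn K E F f U := by
  refine ⟨fun x hx => ?_, fun e he e' he' n => CnOn.of_locally fun x hx => ?_⟩
  · obtain ⟨V, hV, hxV, -, hf⟩ := h x hx
    exact (hf.1.continuousAt (hV.mem_nhds hxV)).continuousWithinAt
  · obtain ⟨V, hV, hxV, hVU, hf⟩ := h _ hx.2.1
    exact ⟨e.target ∩ e.symm ⁻¹' (V ∩ f ⁻¹' e'.source),
      e.isOpen_inter_preimage_symm (hf.1.isOpen_inter_preimage hV e'.open_source),
      ⟨hx.1, hxV, hx.2.2⟩, fun y hy => ⟨hy.1, hVU hy.2.1, hy.2.2⟩, hf.2 e he e' he' n⟩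

theorem SmoothNearOne.mapSmoothOn_univ [Group M] [LCLieGroup K E M] [Group P] [LCLieGroup K F P]
    {f : M →* P} (hf : SmoothNearOne K E F f) : MapSmoothOn K E F f univ := by
  obtain ⟨U, hU, h1, hf⟩ := hf
  refine MapSmoothOn.of_locally fun x _ => ?_
  have hx : MapSmoothOn K E E (fun y : M => x⁻¹ * y) univ :=
    MapSmoothOn.mul isOpen_univ (MapSmoothOn.const _ _) LCLieGroup.chart_smooth
  have hxU : IsOpen ((fun y : M => x⁻¹ * y) ⁻¹' U) := hU.preimage hx.continuous
  have translate : MapSmoothOn K E F (fun y => f x * f (x⁻¹ * y)) ((fun y => x⁻¹ * y) ⁻¹' U) :=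
    MapSmoothOn.mul hxU (MapSmoothOn.const _ _)
      (MapSmoothOn.comp hxU hU (mapsTo_preimage _ _) hf (hx.mono (subset_univ _)))
  exact ⟨_, hxU, by simpa using h1, subset_univ _, translate.congr hxU fun y _ => by simp⟩

end Smoothness

section Center

variable {ι G N : Type*} [Group N]

theorem mulAut_conj_eq_one_iff {n : N} : MulAut.conj n = 1 ↔ n ∈ Subgroup.center N := by
  simp only [MulEquiv.ext_iff, MulAut.conj_apply, MulAut.one_apply, mul_inv_eq_iff_eq_mul,
    Subgroup.mem_center_iff]
  exact forall_congr' fun _ => eq_comm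

theorem center_smul_right_cancel {β β' : ι → Subgroup.center N} {ω : ι → N}
    (h : β • ω = β' • ω) : β = β' :=
  funext fun x => Subtype.ext (mul_right_cancel (congrFun h x))

theorem exists_eq_center_smul {ω ω' : ι → N} (h : ∀ x, MulAut.conj (ω x) = MulAut.conj (ω' x)) :
    ∃ β : ι → Subgroup.center N, ω' = β • ω := by
  have hc : ∀ x, ω' x * (ω x)⁻¹ ∈ Subgroup.center N := fun x => by
    rw [← mulAut_conj_eq_one_iff, map_mul, map_inv, h, mul_inv_cancel]
  exact ⟨fun x => ⟨_, hc x⟩, funext fun x => by simp [Subgroup.smul_def]⟩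

variable [Mul G]

/-- If a section `σ` has factor system `(S, ω)`, this is the `N`-valued cocycle of the section
`ι(h) σ`. -/
def shiftCocycle (S : G → MulAut N) (h : G → N) (ω : G × G → N) : G × G → N :=
  fun x => h x.1 * S x.1 (h x.2) * ω x * (h (x.1 * x.2))⁻¹

theorem shiftCocycle_center_smul (S : G → MulAut N) (h : G → N) (β : G × G → Subgroup.center N)
    (ω : G × G → N) : shiftCocycle S h (β • ω) = β • shiftCocycle S h ω := by
  ext x
  simp only [shiftCocycle, Pi.smul_apply', mul_smul_comm, smul_mul_assoc]

/-- The cocycle identity satisfied by the `ω`-component of a factor system `(S, ω)`. -/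
def IsTwistedCocycle (S : G → MulAut N) (ω : G × G → N) : Prop :=
  ∀ g g' g'', S g (ω (g', g'')) * ω (g, g' * g'') = ω (g, g') * ω (g * g', g'')

end Center

section CentralCochains

variable {K EG EN : Type*} [RCLike K]
  [AddCommGroup EG] [Module K EG] [TopologicalSpace EG]
  [AddCommGroup EN] [Module K EN] [TopologicalSpace EN] [LocallyConvexTVS K EN]
  {G N : Type*} [Group G] [TopologicalSpace G] [ChartedSpace EG G]
  [Group N] [TopologicalSpace N] [ChartedSpace EN N] [LCLieGroup K EN N]

variable {S : SmoothOuterAction K EG EN G N}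

theorem shiftCocycle_coe_center (z : G → Subgroup.center N) (ω : G × G → N) :
    shiftCocycle S.toFun (fun g => (z g : N)) ω = S.d₁ z • ω := by
  ext ⟨g, g'⟩
  have hc := Subgroup.mem_center_iff.1 (z (g * g'))⁻¹.2 (ω (g, g'))
  rw [InvMemClass.coe_inv] at hc
  calc (z g * S.centerAct g (z g') : Subgroup.center N) * ω (g, g') * ((z (g * g'))⁻¹ : N)
      = (z g * S.centerAct g (z g') * (z (g * g'))⁻¹ : Subgroup.center N) * ω (g, g') := by
        rw [mul_assoc, hc, ← mul_assoc]; rfl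
    _ = S.d₁ z (g, g') * ω (g, g') := by
        rw [mul_assoc (z g), mul_comm (z g)]; rfl

theorem IsTwistedCocycle.d₂_eq_one {β : G × G → Subgroup.center N} {ω : G × G → N}
    (hω : IsTwistedCocycle S.toFun ω) (hβω : IsTwistedCocycle S.toFun (β • ω)) :
    S.d₂ β = 1 := by
  ext1 ⟨g, g', g''⟩
  have hS : S.toFun g (β (g', g'') • ω (g', g'')) =
      S.centerAct g (β (g', g'')) • S.toFun g (ω (g', g'')) :=
    map_mul (S.toFun g) _ _
  have e := hβω g g' g''
  simp only [Pi.smul_apply', hS, smul_mul_smul_comm, hω g g' g''] at e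
  have e : S.centerAct g (β (g', g'')) * β (g, g' * g'') = β (g, g') * β (g * g', g'') :=
    Subtype.ext (mul_right_cancel e)
  calc S.d₂ β (g, g', g'')
      = S.centerAct g (β (g', g'')) * β (g, g' * g'') * (β (g, g') * β (g * g', g''))⁻¹ := by
        simp only [SmoothOuterAction.d₂, MonoidHom.coe_mk, OneHom.coe_mk, mul_inv]
        ac_rfl
    _ = 1 := by rw [e, mul_inv_cancel]

variable [LocallyConvexTVS K EG]

theorem SmoothOuterAction.H₂ss_mk_eq_mk_iff (S : SmoothOuterAction K EG EN G N) {β β' : S.Z₂ss} :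
    (β : S.H₂ss) = β' ↔ β.1⁻¹ * β'.1 ∈ S.B₂ :=
  QuotientGroup.eq

theorem KernelEquiv.symm {S S' : G → MulAut N} (h : KernelEquiv K EG EN S S') :
    KernelEquiv K EG EN S' S := by
  obtain ⟨h, hh, e⟩ := h
  exact ⟨fun g => (h g)⁻¹, ⟨by simp [hh.1], hh.2.inv⟩, fun g => by simp [e]⟩

theorem IsCochain₂ss.mem_centralC₂ss {β : G × G → Subgroup.center N} {ω : G × G → N}
    (hω : IsCochain₂ss K EG EN ω) (hβω : IsCochain₂ss K EG EN (β • ω)) :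
    β ∈ CentralC₂ss K EG EN G N := by
  have hβ : (fun x => (β x : N)) = fun x => (β • ω) x * (ω x)⁻¹ := by
    ext x
    simp [Subgroup.smul_def]
  refine ⟨⟨fun g g' h => ?_, hβ ▸ hβω.1.2.mul hω.1.2.inv⟩, fun g => ?_⟩
  · simpa [hω.1.1 g g' h, hβω.1.1 g g' h] using congrFun hβ (g, g')
  · convert (hβω.2 g).mul (hω.2 g).inv using 2 with x
    simp only [Pi.smul_apply', smul_inv, smul_mul_smul_comm]
    simp [Subgroup.smul_def, mul_assoc]

variable [LCLieGroup K EG G]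

/-- The pullback `φ ∘ ω ∘ (ψ⁻¹ × ψ⁻¹)` of `ω : G × G → N`; for central `ω` this is
`centralPull₂`. -/
def pairPull₂ (p : LieAut K EN N × LieAut K EG G) (ω : G × G → N) : G × G → N :=
  fun x => (p.1 : MulAut N) (ω ((p.2 : MulAut G)⁻¹ x.1, (p.2 : MulAut G)⁻¹ x.2))

theorem pairPull₂_center_smul (p : LieAut K EN N × LieAut K EG G)
    (β : G × G → Subgroup.center N) (ω : G × G → N) :
    pairPull₂ p (β • ω) = centralPull₂ p β • pairPull₂ p ω :=
  funext fun _ => map_mul (p.1 : MulAut N) _ _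

end CentralCochains

namespace LieGroupExtension

variable {K EN EH EG N H G : Type*} [RCLike K]
  [AddCommGroup EN] [Module K EN] [TopologicalSpace EN] [LocallyConvexTVS K EN]
  [AddCommGroup EH] [Module K EH] [TopologicalSpace EH] [LocallyConvexTVS K EH]
  [AddCommGroup EG] [Module K EG] [TopologicalSpace EG] [LocallyConvexTVS K EG]
  [Group N] [TopologicalSpace N] [ChartedSpace EN N] [LCLieGroup K EN N]
  [Group H] [TopologicalSpace H] [ChartedSpace EH H] [LCLieGroup K EH H]
  [Group G] [TopologicalSpace G] [ChartedSpace EG G] [LCLieGroup K EG G]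

section Basic

variable (X : LieGroupExtension K EN EH EG N H G)

@[simp]
theorem q_ι (n : N) : X.q (X.ι n) = 1 := by
  have h : X.ι n ∈ X.ι.range := ⟨n, rfl⟩
  rwa [X.range_eq_ker] at h

theorem exists_ι_eq {y : H} (hy : X.q y = 1) : ∃ n, X.ι n = y := by
  have h : y ∈ X.q.ker := hy
  rwa [← X.range_eq_ker] at h

@[simp]
theorem twist_ι_apply (p : LieAut K EN N × LieAut K EG G) (n : N) :
    (X.twist p).ι n = X.ι ((p.1 : MulAut N)⁻¹ n) :=
  rfl

@[simp]
theorem twist_q_apply (p : LieAut K EN N × LieAut K EG G) (x : H) :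
    (X.twist p).q x = (p.2 : MulAut G) (X.q x) :=
  rfl

theorem twist_one : X.twist 1 = X :=
  rfl

theorem twist_twist (p p' : LieAut K EN N × LieAut K EG G) :
    (X.twist p').twist p = X.twist (p * p') :=
  rfl

variable {E M : Type*} [AddCommGroup E] [Module K E] [TopologicalSpace E] [LocallyConvexTVS K E]
  [TopologicalSpace M] [ChartedSpace E M]

theorem mapSmoothOn_of_comp_ι {f : M → N} {U : Set M} (hU : IsOpen U)
    (hf : MapSmoothOn K E EH (fun x => X.ι (f x)) U) : MapSmoothOn K E EN f U := by
  obtain ⟨V, hV, h1, s, r, -, hr, -, hsr⟩ := X.locally_trivial 1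
  have hmem (n : N) : X.ι n ∈ X.q ⁻¹' V := by simpa using h1
  have hr_ι (n : N) : (r 1)⁻¹ * r (X.ι n) = n := X.ι_injective <| by
    have e1 := hsr 1 (by simpa using hmem 1)
    have en := hsr _ (hmem n)
    rw [map_one] at e1
    rw [q_ι, eq_inv_of_mul_eq_one_left e1.symm] at en
    rw [map_mul, map_inv, ← en]
  exact (MapSmoothOn.mul hU (MapSmoothOn.const (r 1)⁻¹ U)
    (MapSmoothOn.comp hU (hV.preimage X.q_smooth.continuous) (fun x _ => hmem (f x)) hr hf)).congr
    hU fun x _ => hr_ι (f x)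

variable [One M]

theorem smoothNearOne_of_comp_ι {f : M → N}
    (hf : SmoothNearOne K E EH (fun x => X.ι (f x))) : SmoothNearOne K E EN f :=
  let ⟨U, hU, h1, hf⟩ := hf
  ⟨U, hU, h1, X.mapSmoothOn_of_comp_ι hU hf⟩

theorem exists_eq_ι_mul {f f' : M → H} (hf : SmoothNearOne K E EH f)
    (hf' : SmoothNearOne K E EH f') (hq : ∀ x, X.q (f x) = X.q (f' x)) :
    ∃ h : M → N, SmoothNearOne K E EN h ∧ ∀ x, f x = X.ι (h x) * f' x := by
  choose h hh using fun x => X.exists_ι_eq (y := f x * (f' x)⁻¹) (by simp [hq])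
  exact ⟨h, X.smoothNearOne_of_comp_ι (by simpa only [hh] using hf.mul hf'.inv),
    fun x => by simp [hh]⟩

end Basic

section FactorSection

/-- `σ` is a normalized locally smooth section of `q` with factor system `(S, ω)`: the data whose
existence is asserted by `HasFactorSystem`. -/
structure IsFactorSection (X : LieGroupExtension K EN EH EG N H G) (S : G → MulAut N)
    (ω : G × G → N) (σ : G → H) : Prop where
  isCochain₁ : IsCochain₁ K EG EH σ
  q_apply : ∀ g, X.q (σ g) = g
  ι_act : ∀ g n, X.ι (S g n) = σ g * X.ι n * (σ g)⁻¹
  ι_cocycle : ∀ g g', X.ι (ω (g, g')) = σ g * σ g' * (σ (g * g'))⁻¹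

variable {X : LieGroupExtension K EN EH EG N H G} {S S' : G → MulAut N} {ω ω' : G × G → N}
  {σ τ : G → H}

theorem HasFactorSystem.exists_isFactorSection (hX : X.HasFactorSystem S ω) :
    ∃ σ, X.IsFactorSection S ω σ :=
  let ⟨σ, hσ, hq, hS, hω⟩ := hX
  ⟨σ, hσ, hq, hS, hω⟩

namespace IsFactorSection

theorem hasFactorSystem (hσ : X.IsFactorSection S ω σ) : X.HasFactorSystem S ω :=
  ⟨σ, hσ.isCochain₁, hσ.q_apply, hσ.ι_act, hσ.ι_cocycle⟩

theorem unique (hσ : X.IsFactorSection S ω σ) (hσ' : X.IsFactorSection S' ω' σ) :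
    S = S' ∧ ω = ω' :=
  ⟨funext fun g => MulEquiv.ext fun n => X.ι_injective (by rw [hσ.ι_act, hσ'.ι_act]),
    funext fun ⟨g, g'⟩ => X.ι_injective (by rw [hσ.ι_cocycle, hσ'.ι_cocycle])⟩

theorem exists_eq_ι_mul (hσ : X.IsFactorSection S ω σ) (y : H) : ∃ n g, y = X.ι n * σ g := by
  obtain ⟨n, hn⟩ := X.exists_ι_eq (y := y * (σ (X.q y))⁻¹) (by simp [hσ.q_apply])
  exact ⟨n, X.q y, by simp [hn]⟩

theorem conj_eq (hσ : X.IsFactorSection S ω σ) (g g' : G) :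
    MulAut.conj (ω (g, g')) = S g * S g' * (S (g * g'))⁻¹ := by
  rw [eq_mul_inv_iff_mul_eq]
  ext n
  apply X.ι_injective
  simp [hσ.ι_act, hσ.ι_cocycle, mul_assoc]

theorem isTwistedCocycle (hσ : X.IsFactorSection S ω σ) : IsTwistedCocycle S ω := fun g g' g'' =>
  X.ι_injective (by simp [hσ.ι_act, hσ.ι_cocycle, mul_assoc])

theorem isCochain₂ss (hσ : X.IsFactorSection S ω σ) : IsCochain₂ss K EG EN ω := by
  have hσ₁ := hσ.isCochain₁.2
  refine ⟨⟨fun g g' h => X.ι_injective ?_, X.smoothNearOne_of_comp_ι ?_⟩, fun g =>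
    X.smoothNearOne_of_comp_ι ?_⟩
  · rcases h with rfl | rfl <;> simp [hσ.ι_cocycle, hσ.isCochain₁.1]
  · have h_fst := hσ₁.comp_right (g := (Prod.fst : G × G → G))
      (MapSmoothOn.fst (H := EG) LCLieGroup.chart_smooth) rfl
    have h_snd := hσ₁.comp_right (g := (Prod.snd : G × G → G))
      (MapSmoothOn.snd (F := EG) LCLieGroup.chart_smooth) rfl
    have h_mul := hσ₁.comp_right (g := (fun p : G × G => p.1 * p.2)) LCLieGroup.mul_smooth
      (mul_one 1)
    simpa only [← hσ.ι_cocycle] using (h_fst.mul h_snd).mul h_mul.inv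
  · have h_conj : MapSmoothOn K EG EG (fun x : G => g * x * g⁻¹) univ :=
      MapSmoothOn.mul isOpen_univ (MapSmoothOn.mul isOpen_univ (MapSmoothOn.const _ _)
        LCLieGroup.chart_smooth) (MapSmoothOn.const _ _)
    have hι (x : G) : X.ι (ω (g, x) * (ω (g * x * g⁻¹, g))⁻¹) =
        σ g * σ x * (σ g)⁻¹ * (σ (g * x * g⁻¹))⁻¹ := by
      simp [hσ.ι_cocycle, mul_assoc]
    simpa only [hι] using (((SmoothNearOne.const (σ g)).mul hσ₁).mul
      (SmoothNearOne.const (σ g)⁻¹)).mul (hσ₁.comp_right h_conj (by simp)).inv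

theorem ι_mul (hσ : X.IsFactorSection S ω σ) {h : G → N} (hh : IsCochain₁ K EG EN h)
    (e : ∀ g, S' g = MulAut.conj (h g) * S g) :
    X.IsFactorSection S' (shiftCocycle S h ω) fun g => X.ι (h g) * σ g where
  isCochain₁ := ⟨by simp [hh.1, hσ.isCochain₁.1], (hh.2.comp_left X.ι_smooth).mul hσ.isCochain₁.2⟩
  q_apply g := by simp [hσ.q_apply]
  ι_act g n := by simp [e, hσ.ι_act, mul_assoc]
  ι_cocycle g g' := by simp [shiftCocycle, hσ.ι_act, hσ.ι_cocycle, mul_assoc]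

theorem exists_cochain₁ (hσ : X.IsFactorSection S ω σ) (hτ : X.IsFactorSection S' ω' τ) :
    ∃ h : G → N, IsCochain₁ K EG EN h ∧ (∀ g, τ g = X.ι (h g) * σ g) ∧
      (∀ g, S' g = MulAut.conj (h g) * S g) ∧ ω' = shiftCocycle S h ω := by
  obtain ⟨h, hh, e⟩ := X.exists_eq_ι_mul hτ.isCochain₁.2 hσ.isCochain₁.2
    fun g => by rw [hτ.q_apply, hσ.q_apply]
  have h1 : h 1 = 1 := X.ι_injective (by simpa [hσ.isCochain₁.1, hτ.isCochain₁.1] using (e 1).symm)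
  obtain ⟨hS, hω⟩ := hτ.unique (funext e ▸ hσ.ι_mul ⟨h1, hh⟩ fun _ => rfl)
  exact ⟨h, ⟨h1, hh⟩, e, congrFun hS, hω⟩

theorem twist (hσ : X.IsFactorSection S ω σ) (p : LieAut K EN N × LieAut K EG G) :
    (X.twist p).IsFactorSection (pairAct p S) (pairPull₂ p ω)
      fun g => σ ((p.2 : MulAut G)⁻¹ g) where
  isCochain₁ :=
    ⟨by simp [hσ.isCochain₁.1], hσ.isCochain₁.2.comp_right (p.2⁻¹).2.1 (map_one _)⟩
  q_apply g := by simp [hσ.q_apply]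
  ι_act g n := by simp [pairAct, hσ.ι_act]
  ι_cocycle g g' := by simp [pairPull₂, hσ.ι_cocycle]

end IsFactorSection

end FactorSection

section OuterAction

variable {S : SmoothOuterAction K EG EN G N} {X : LieGroupExtension K EN EH EG N H G}
  {ω ω' : G × G → N} {σ τ : G → H}

namespace IsFactorSection

theorem center_ι_mul (hσ : X.IsFactorSection S.toFun ω σ) {z : G → Subgroup.center N}
    (hz : z ∈ CentralC₁ K EG EN G N) :
    X.IsFactorSection S.toFun (S.d₁ z • ω) fun g => X.ι (z g) * σ g :=
  shiftCocycle_coe_center (S := S) z ω ▸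
    hσ.ι_mul (h := fun g => z g) hz fun g => by rw [mulAut_conj_eq_one_iff.2 (z g).2, one_mul]

theorem exists_mem_centralC₁ (hσ : X.IsFactorSection S.toFun ω σ)
    (hτ : X.IsFactorSection S.toFun ω' τ) :
    ∃ z ∈ CentralC₁ K EG EN G N, (∀ g, τ g = X.ι (z g) * σ g) ∧ ω' = S.d₁ z • ω := by
  obtain ⟨h, hh, e, hS, hω⟩ := hσ.exists_cochain₁ hτ
  have hc (g : G) : h g ∈ Subgroup.center N :=
    mulAut_conj_eq_one_iff.1 (by simpa using hS g)
  let z (g : G) : Subgroup.center N := ⟨h g, hc g⟩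
  exact ⟨z, hh, e, hω.trans (shiftCocycle_coe_center z ω)⟩

end IsFactorSection

namespace HasFactorSystem

theorem shift {T T' : G → MulAut N} (hX : X.HasFactorSystem T ω) {h : G → N}
    (hh : IsCochain₁ K EG EN h) (e : ∀ g, T' g = MulAut.conj (h g) * T g) :
    X.HasFactorSystem T' (shiftCocycle T h ω) :=
  let ⟨_, hσ⟩ := hX.exists_isFactorSection
  (hσ.ι_mul hh e).hasFactorSystem

theorem kernelEquiv {T T' : G → MulAut N} (hX : X.HasFactorSystem T ω)
    (hX' : X.HasFactorSystem T' ω') : KernelEquiv K EG EN T T' :=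
  let ⟨_, hσ⟩ := hX.exists_isFactorSection
  let ⟨_, hτ⟩ := hX'.exists_isFactorSection
  let ⟨h, hh, _, e, _⟩ := hσ.exists_cochain₁ hτ
  ⟨h, hh, e⟩

theorem twist {T : G → MulAut N} (hX : X.HasFactorSystem T ω)
    (p : LieAut K EN N × LieAut K EG G) :
    (X.twist p).HasFactorSystem (pairAct p T) (pairPull₂ p ω) :=
  let ⟨_, hσ⟩ := hX.exists_isFactorSection
  (hσ.twist p).hasFactorSystem

theorem smul_of_mem_B₂ (hX : X.HasFactorSystem S.toFun ω) {b : G × G → Subgroup.center N}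
    (hb : b ∈ S.B₂) : X.HasFactorSystem S.toFun (b • ω) := by
  obtain ⟨z, hz, rfl⟩ := hb
  obtain ⟨σ, hσ⟩ := hX.exists_isFactorSection
  exact (hσ.center_ι_mul hz).hasFactorSystem

theorem exists_mem_B₂ (hX : X.HasFactorSystem S.toFun ω) (hX' : X.HasFactorSystem S.toFun ω') :
    ∃ b ∈ S.B₂, ω' = b • ω := by
  obtain ⟨σ, hσ⟩ := hX.exists_isFactorSection
  obtain ⟨τ, hτ⟩ := hX'.exists_isFactorSection
  obtain ⟨z, hz, -, hω⟩ := hσ.exists_mem_centralC₁ hτ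
  exact ⟨S.d₁ z, ⟨z, hz, rfl⟩, hω⟩

variable {EH' H' : Type*}
  [AddCommGroup EH'] [Module K EH'] [TopologicalSpace EH'] [LocallyConvexTVS K EH']
  [Group H'] [TopologicalSpace H'] [ChartedSpace EH' H'] [LCLieGroup K EH' H']
  {X' : LieGroupExtension K EN EH' EG N H' G}

theorem exists_mem_Z₂ss (hX : X.HasFactorSystem S.toFun ω)
    (hX' : X'.HasFactorSystem S.toFun ω') : ∃ β ∈ S.Z₂ss, ω' = β • ω := by
  obtain ⟨σ, hσ⟩ := hX.exists_isFactorSection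
  obtain ⟨σ', hσ'⟩ := hX'.exists_isFactorSection
  obtain ⟨β, rfl⟩ := exists_eq_center_smul (ω := ω) (ω' := ω') fun ⟨g, g'⟩ => by
    rw [hσ.conj_eq, hσ'.conj_eq]
  exact ⟨β, ⟨hσ.isCochain₂ss.mem_centralC₂ss hσ'.isCochain₂ss,
    hσ.isTwistedCocycle.d₂_eq_one hσ'.isTwistedCocycle⟩, rfl⟩

end HasFactorSystem

theorem HasKernel.exists_hasFactorSystem (hX : X.HasKernel S) :
    ∃ ω, X.HasFactorSystem S.toFun ω := by
  obtain ⟨S', ω', hX, hS⟩ := hX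
  obtain ⟨h, hh, e⟩ := hS.symm
  exact ⟨_, hX.shift hh e⟩

theorem HasKernel.twist (hX : X.HasKernel S) (p : S.Comp) : (X.twist p).HasKernel S := by
  obtain ⟨ω, hω⟩ := hX.exists_hasFactorSystem
  exact ⟨_, _, hω.twist p, p.2.symm⟩

end OuterAction

end LieGroupExtension

namespace LieGroupExtension

variable {K EN EH EH' EH'' EG N H H' H'' G : Type*} [RCLike K]
  [AddCommGroup EN] [Module K EN] [TopologicalSpace EN] [LocallyConvexTVS K EN]
  [AddCommGroup EH] [Module K EH] [TopologicalSpace EH] [LocallyConvexTVS K EH]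
  [AddCommGroup EH'] [Module K EH'] [TopologicalSpace EH'] [LocallyConvexTVS K EH']
  [AddCommGroup EH''] [Module K EH''] [TopologicalSpace EH''] [LocallyConvexTVS K EH'']
  [AddCommGroup EG] [Module K EG] [TopologicalSpace EG] [LocallyConvexTVS K EG]
  [Group N] [TopologicalSpace N] [ChartedSpace EN N] [LCLieGroup K EN N]
  [Group H] [TopologicalSpace H] [ChartedSpace EH H] [LCLieGroup K EH H]
  [Group H'] [TopologicalSpace H'] [ChartedSpace EH' H'] [LCLieGroup K EH' H']
  [Group H''] [TopologicalSpace H''] [ChartedSpace EH'' H''] [LCLieGroup K EH'' H'']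
  [Group G] [TopologicalSpace G] [ChartedSpace EG G] [LCLieGroup K EG G]
  {S : SmoothOuterAction K EG EN G N}
  {X : LieGroupExtension K EN EH EG N H G} {X' : LieGroupExtension K EN EH' EG N H' G}
  {X'' : LieGroupExtension K EN EH'' EG N H'' G}

section Equivalence

/-- `f` is an equivalence of extensions: an isomorphism of the total groups, smooth in both
directions, that induces the identity on `N` and on `G`. -/
structure IsEquivalence (X : LieGroupExtension K EN EH EG N H G)
    (X' : LieGroupExtension K EN EH' EG N H' G) (f : H ≃* H') : Prop where
  smooth : MapSmoothOn K EH EH' f univ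
  smooth_symm : MapSmoothOn K EH' EH f.symm univ
  apply_ι : ∀ n, f (X.ι n) = X'.ι n
  q_apply : ∀ x, X'.q (f x) = X.q x

theorem IsEquivalence.symm {f : H ≃* H'} (hf : IsEquivalence X X' f) :
    IsEquivalence X' X f.symm where
  smooth := hf.smooth_symm
  smooth_symm := hf.smooth
  apply_ι n := by rw [← hf.apply_ι, f.symm_apply_apply]
  q_apply x := by rw [← hf.q_apply, f.apply_symm_apply]

theorem IsEquivalence.trans {f : H ≃* H'} {f' : H' ≃* H''} (hf : IsEquivalence X X' f)
    (hf' : IsEquivalence X' X'' f') : IsEquivalence X X'' (f.trans f') where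
  smooth := hf'.smooth.comp_univ hf.smooth
  smooth_symm := hf.smooth_symm.comp_univ hf'.smooth_symm
  apply_ι n := by simp [hf.apply_ι, hf'.apply_ι]
  q_apply x := by simp [hf.q_apply, hf'.q_apply]

theorem IsEquivalence.twist {f : H ≃* H'} (hf : IsEquivalence X X' f)
    (p : LieAut K EN N × LieAut K EG G) : IsEquivalence (X.twist p) (X'.twist p) f where
  smooth := hf.smooth
  smooth_symm := hf.smooth_symm
  apply_ι _ := hf.apply_ι _
  q_apply x := congrArg (p.2 : MulAut G) (hf.q_apply x)

namespace IsFactorSection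

variable {T : G → MulAut N} {ω : G × G → N} {σ : G → H} {σ' : G → H'}

theorem map (hσ : X.IsFactorSection T ω σ) {f : H ≃* H'} (hf : IsEquivalence X X' f) :
    X'.IsFactorSection T ω fun g => f (σ g) where
  isCochain₁ := ⟨by simp [hσ.isCochain₁.1], hσ.isCochain₁.2.comp_left hf.smooth⟩
  q_apply g := by rw [hf.q_apply, hσ.q_apply]
  ι_act g n := by simp [← hf.apply_ι, hσ.ι_act]
  ι_cocycle g g' := by simp [← hf.apply_ι, hσ.ι_cocycle]

theorem exists_hom (hσ : X.IsFactorSection T ω σ) (hσ' : X'.IsFactorSection T ω σ') :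
    ∃ f : H →* H', MapSmoothOn K EH EH' f univ ∧ ∀ n g, f (X.ι n * σ g) = X'.ι n * σ' g := by
  have hid : SmoothNearOne K EH EH (fun y : H => y) := LCLieGroup.chart_smooth.smoothNearOne
  obtain ⟨ρ, hρ, e⟩ := X.exists_eq_ι_mul hid
    (hσ.isCochain₁.2.comp_right X.q_smooth (map_one _)) fun y => (hσ.q_apply _).symm
  have hιρ (y : H) : X.ι (ρ y) = y * (σ (X.q y))⁻¹ := eq_mul_inv_of_mul_eq (e y).symm
  have hρ_mul (y y' : H) : ρ (y * y') = ρ y * T (X.q y) (ρ y') * ω (X.q y, X.q y') :=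
    X.ι_injective (by simp [hιρ, hσ.ι_act, hσ.ι_cocycle, mul_assoc])
  let f : H →* H' := MonoidHom.mk' (fun y => X'.ι (ρ y) * σ' (X.q y)) fun y y' => by
    simp [hρ_mul, hσ'.ι_act, hσ'.ι_cocycle, mul_assoc]
  have hf : SmoothNearOne K EH EH' f :=
    (hρ.comp_left X'.ι_smooth).mul (hσ'.isCochain₁.2.comp_right X.q_smooth (map_one _))
  refine ⟨f, hf.mapSmoothOn_univ, fun n g => ?_⟩
  have hn : ρ (X.ι n * σ g) = n := X.ι_injective (by simp [hιρ, hσ.q_apply])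
  simp [f, hn, hσ.q_apply]

theorem exists_isEquivalence (hσ : X.IsFactorSection T ω σ) (hσ' : X'.IsFactorSection T ω σ') :
    ∃ f : H ≃* H', IsEquivalence X X' f ∧ ∀ g, f (σ g) = σ' g := by
  obtain ⟨f, hf, e⟩ := hσ.exists_hom hσ'
  obtain ⟨f', hf', e'⟩ := hσ'.exists_hom hσ
  have left_inv : f'.comp f = MonoidHom.id H := by
    ext y
    obtain ⟨n, g, rfl⟩ := hσ.exists_eq_ι_mul y
    rw [MonoidHom.comp_apply, e, e', MonoidHom.id_apply]
  have right_inv : f.comp f' = MonoidHom.id H' := by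
    ext y
    obtain ⟨n, g, rfl⟩ := hσ'.exists_eq_ι_mul y
    rw [MonoidHom.comp_apply, e', e, MonoidHom.id_apply]
  have hq (y : H) : X'.q (f y) = X.q y := by
    obtain ⟨n, g, rfl⟩ := hσ.exists_eq_ι_mul y
    simp [e, hσ.q_apply, hσ'.q_apply]
  exact ⟨f.toMulEquiv f' left_inv right_inv,
    ⟨hf, hf', fun n => by simpa [hσ.isCochain₁.1, hσ'.isCochain₁.1] using e n 1, hq⟩,
    fun g => by simpa using e 1 g⟩

end IsFactorSection

end Equivalence

section OfCocycle

theorem IsEquivalence.apply_eq_ι_mul {T : G → MulAut N} {ω : G × G → N} {σ : G → H}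
    (hσ : X.IsFactorSection T ω σ) {ν : MulAut H} (hν : IsEquivalence X X ν)
    {z : G → Subgroup.center N} (e : ∀ g, ν (σ g) = X.ι (z g) * σ g) (x : H) :
    ν x = X.ι (z (X.q x)) * x := by
  obtain ⟨n, g, rfl⟩ := hσ.exists_eq_ι_mul x
  have hc : n * z g = z g * n := Subgroup.mem_center_iff.1 (z g).2 n
  have hq : X.q (X.ι n * σ g) = g := by simp [hσ.q_apply]
  rw [map_mul, hν.apply_ι, e, hq, ← mul_assoc, ← mul_assoc, ← map_mul, ← map_mul, hc]

theorem HasKernel.exists_isEquivalence_of_mem_Z₁ (hX : X.HasKernel S)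
    {z : G → Subgroup.center N} (hz : z ∈ S.Z₁) :
    ∃ ν : MulAut H, IsEquivalence X X ν ∧ ∀ x, ν x = X.ι (z (X.q x)) * x := by
  obtain ⟨ω, hω⟩ := hX.exists_hasFactorSystem
  obtain ⟨σ, hσ⟩ := hω.exists_isFactorSection
  have hzσ := hσ.center_ι_mul hz.1
  rw [show S.d₁ z = 1 from hz.2, one_smul] at hzσ
  obtain ⟨ν, hν, e⟩ := hσ.exists_isEquivalence hzσ
  exact ⟨ν, hν, hν.apply_eq_ι_mul hσ e⟩

theorem IsEquivalence.exists_mem_Z₁ {ν : MulAut H} (hν : IsEquivalence X X ν)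
    (hX : X.HasKernel S) : ∃ z ∈ S.Z₁, ∀ x, ν x = X.ι (z (X.q x)) * x := by
  obtain ⟨ω, hω⟩ := hX.exists_hasFactorSystem
  obtain ⟨σ, hσ⟩ := hω.exists_isFactorSection
  obtain ⟨z, hz, e, hzω⟩ := hσ.exists_mem_centralC₁ (hσ.map hν)
  have hd : S.d₁ z = 1 := center_smul_right_cancel (by rw [one_smul, ← hzω])
  exact ⟨z, ⟨hz, hd⟩, hν.apply_eq_ι_mul hσ e⟩

end OfCocycle

section Twist

variable {p p' : LieAut K EN N × LieAut K EG G} {ν : MulAut H}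

theorem isEquivalence_twist_iff : IsEquivalence (X.twist p) X ν ↔ ν ∈ LieAut K EH H ∧
    (∀ n, X.ι ((p.1 : MulAut N) n) = ν (X.ι n)) ∧ ∀ x, (p.2 : MulAut G) (X.q x) = X.q (ν x) := by
  refine ⟨fun h => ⟨⟨h.smooth, h.smooth_symm⟩, fun n => ?_, fun x => (h.q_apply x).symm⟩,
    fun ⟨hν, hN, hG⟩ => ⟨hν.1, hν.2, fun n => ?_, fun x => (hG x).symm⟩⟩
  · simpa using (h.apply_ι ((p.1 : MulAut N) n)).symm
  · simp [← hN]

theorem IsEquivalence.twist_unique (hν : IsEquivalence (X.twist p) X ν)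
    (hν' : IsEquivalence (X.twist p') X ν) : p = p' := by
  obtain ⟨-, hN, hG⟩ := isEquivalence_twist_iff.1 hν
  obtain ⟨-, hN', hG'⟩ := isEquivalence_twist_iff.1 hν'
  refine Prod.ext (Subtype.ext (MulEquiv.ext fun n => X.ι_injective (by rw [hN, hN'])))
    (Subtype.ext (MulEquiv.ext fun g => ?_))
  obtain ⟨x, rfl⟩ := X.q_surjective g
  rw [hG, hG']

theorem IsEquivalence.mem_aut_of_twist (hν : IsEquivalence (X.twist p) X ν) : ν ∈ X.Aut := by
  obtain ⟨hν, hN, -⟩ := isEquivalence_twist_iff.1 hν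
  refine ⟨hν, ?_⟩
  rw [← range_comp, show ν ∘ X.ι = X.ι ∘ (p.1 : MulAut N) from funext fun n => (hN n).symm,
    (MulEquiv.surjective (p.1 : MulAut N)).range_comp]

theorem exists_restrict (ν : X.Aut) :
    ∃ φ : N →* N, MapSmoothOn K EN EN φ univ ∧ ∀ n, X.ι (φ n) = (ν : MulAut H) (X.ι n) := by
  have h (n : N) : (ν : MulAut H) (X.ι n) ∈ range X.ι :=
    ν.2.2 ▸ mem_image_of_mem _ (mem_range_self n)
  choose φ hφ using h
  refine ⟨MonoidHom.mk' φ fun n m => X.ι_injective (by simp [hφ]),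
    X.mapSmoothOn_of_comp_ι isOpen_univ ?_, hφ⟩
  simpa only [MonoidHom.mk'_apply, hφ] using
    MapSmoothOn.comp_univ (g := (ν : MulAut H)) ν.2.1.1 X.ι_smooth

theorem exists_quotient (ν : X.Aut) :
    ∃ ψ : G →* G, MapSmoothOn K EG EG ψ univ ∧ ∀ x, ψ (X.q x) = X.q ((ν : MulAut H) x) := by
  obtain ⟨φ, -, hφ⟩ := X.exists_restrict ν
  let qν : H →* G := X.q.comp (ν : MulAut H).toMonoidHom
  have hker : X.q.ker ≤ qν.ker := fun x hx => by
    obtain ⟨n, rfl⟩ := X.exists_ι_eq hx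
    change X.q ((ν : MulAut H) (X.ι n)) = 1
    rw [← hφ, q_ι]
  let ψ : G →* G := X.q.liftOfSurjective X.q_surjective ⟨qν, hker⟩
  have hψ : ∀ x, ψ (X.q x) = qν x := X.q.liftOfRightInverse_comp_apply _ _ ⟨qν, hker⟩
  obtain ⟨U, hU, h1, s, -, hs, -, hqs, -⟩ := X.locally_trivial 1
  have hψs : MapSmoothOn K EG EG (fun g => qν (s g)) U :=
    MapSmoothOn.comp hU isOpen_univ (mapsTo_univ _ _)
      (MapSmoothOn.comp_univ (f := (ν : MulAut H)) X.q_smooth ν.2.1.1) hs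
  have hψ1 : SmoothNearOne K EG EG ψ :=
    ⟨U, hU, h1, hψs.congr hU fun g hg => by rw [← hψ, hqs g hg]⟩
  exact ⟨ψ, hψ1.mapSmoothOn_univ, hψ⟩

theorem exists_lieAut_restrict (ν : X.Aut) :
    ∃ φ : LieAut K EN N, ∀ n, X.ι ((φ : MulAut N) n) = (ν : MulAut H) (X.ι n) := by
  obtain ⟨φ, hφ, e⟩ := X.exists_restrict ν
  obtain ⟨φ', hφ', e'⟩ := X.exists_restrict ν⁻¹
  refine ⟨⟨φ.toMulEquiv φ' ?_ ?_, hφ, hφ'⟩, e⟩ <;> ext n <;> apply X.ι_injective <;> simp [e, e']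

theorem exists_lieAut_quotient (ν : X.Aut) :
    ∃ ψ : LieAut K EG G, ∀ x, (ψ : MulAut G) (X.q x) = X.q ((ν : MulAut H) x) := by
  obtain ⟨ψ, hψ, e⟩ := X.exists_quotient ν
  obtain ⟨ψ', hψ', e'⟩ := X.exists_quotient ν⁻¹
  refine ⟨⟨ψ.toMulEquiv ψ' ?_ ?_, hψ, hψ'⟩, e⟩ <;> ext g <;>
    obtain ⟨x, rfl⟩ := X.q_surjective g <;> simp [e, e']

theorem exists_isEquivalence_twist (ν : X.Aut) :
    ∃ p : LieAut K EN N × LieAut K EG G, IsEquivalence (X.twist p) X (ν : MulAut H) :=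
  let ⟨φ, hφ⟩ := X.exists_lieAut_restrict ν
  let ⟨ψ, hψ⟩ := X.exists_lieAut_quotient ν
  ⟨(φ, ψ), isEquivalence_twist_iff.2 ⟨ν.2.1, hφ, hψ⟩⟩

theorem HasKernel.mem_comp (hX : X.HasKernel S) (hν : IsEquivalence (X.twist p) X ν) :
    p ∈ S.Comp := by
  obtain ⟨ω, hω⟩ := hX.exists_hasFactorSystem
  obtain ⟨σ, hσ⟩ := hω.exists_isFactorSection
  exact ((hσ.twist p).map hν).hasFactorSystem.kernelEquiv hω

end Twist

section Automorphisms

namespace HasKernel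

/-- The homomorphism `Ψ : Z¹_s(G, Z(N))_S → Aut(Ĝ, N)`, `Ψ(z)(x) = ι(z(q x)) x`. -/
noncomputable def ofCocycle (hX : X.HasKernel S) : S.Z₁ →* X.Aut :=
  MonoidHom.mk' (fun z =>
    ⟨_, (hX.exists_isEquivalence_of_mem_Z₁ z.2).choose_spec.1.mem_aut_of_twist (p := 1)⟩)
    fun z z' => by
      ext x
      have e (z : S.Z₁) := (hX.exists_isEquivalence_of_mem_Z₁ z.2).choose_spec.2
      refine (e (z * z') x).trans ?_
      simp [e, mul_assoc]

theorem ofCocycle_apply (hX : X.HasKernel S) (z : S.Z₁) (x : H) :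
    (hX.ofCocycle z : MulAut H) x = X.ι (z.1 (X.q x)) * x :=
  (hX.exists_isEquivalence_of_mem_Z₁ z.2).choose_spec.2 x

theorem isEquivalence_ofCocycle (hX : X.HasKernel S) (z : S.Z₁) :
    IsEquivalence X X (hX.ofCocycle z : MulAut H) :=
  (hX.exists_isEquivalence_of_mem_Z₁ z.2).choose_spec.1

theorem ofCocycle_injective (hX : X.HasKernel S) : Function.Injective hX.ofCocycle := by
  intro z z' h
  ext g
  obtain ⟨x, rfl⟩ := X.q_surjective g
  apply X.ι_injective
  apply mul_right_cancel (b := x)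
  rw [← hX.ofCocycle_apply, ← hX.ofCocycle_apply, h]

theorem mem_range_ofCocycle_iff (hX : X.HasKernel S) (ν : X.Aut) :
    ν ∈ hX.ofCocycle.range ↔ IsEquivalence X X (ν : MulAut H) := by
  constructor
  · rintro ⟨z, rfl⟩
    exact hX.isEquivalence_ofCocycle z
  · intro hν
    obtain ⟨z, hz, e⟩ := hν.exists_mem_Z₁ hX
    exact ⟨⟨z, hz⟩, Subtype.ext (MulEquiv.ext fun x => by rw [ofCocycle_apply, e])⟩

/-- The homomorphism `Φ : Aut(Ĝ, N) → Comp(S)`, `ν ↦ (ν_N, ν_G)`, where `(ν_N, ν_G)` is encoded as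
the unique `p` for which `ν` is an equivalence from `p.Ĝ` to `Ĝ`. -/
noncomputable def toComp (hX : X.HasKernel S) : X.Aut →* S.Comp :=
  MonoidHom.mk' (fun ν => ⟨_, hX.mem_comp (exists_isEquivalence_twist ν).choose_spec⟩)
    fun ν ν' => Subtype.ext <| (exists_isEquivalence_twist (ν * ν')).choose_spec.twist_unique <|
      ((exists_isEquivalence_twist ν').choose_spec.twist _).trans
        (exists_isEquivalence_twist ν).choose_spec

theorem toComp_eq_iff (hX : X.HasKernel S) {ν : X.Aut} {p : S.Comp} :
    hX.toComp ν = p ↔ IsEquivalence (X.twist p) X (ν : MulAut H) := by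
  have hν : IsEquivalence (X.twist (hX.toComp ν)) X (ν : MulAut H) :=
    (exists_isEquivalence_twist ν).choose_spec
  exact ⟨fun h => h ▸ hν, fun h => Subtype.ext (hν.twist_unique h)⟩

theorem ι_toComp_apply (hX : X.HasKernel S) (ν : X.Aut) (n : N) :
    X.ι (((hX.toComp ν).1.1 : MulAut N) n) = (ν : MulAut H) (X.ι n) :=
  (isEquivalence_twist_iff.1 (hX.toComp_eq_iff.1 rfl)).2.1 n

theorem toComp_apply_q (hX : X.HasKernel S) (ν : X.Aut) (x : H) :
    ((hX.toComp ν).1.2 : MulAut G) (X.q x) = X.q ((ν : MulAut H) x) :=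
  (isEquivalence_twist_iff.1 (hX.toComp_eq_iff.1 rfl)).2.2 x

theorem range_ofCocycle (hX : X.HasKernel S) : hX.ofCocycle.range = hX.toComp.ker := by
  ext ν
  rw [mem_range_ofCocycle_iff, MonoidHom.mem_ker, toComp_eq_iff, OneMemClass.coe_one, twist_one]

theorem mem_range_toComp_iff_exists (hX : X.HasKernel S) {p : S.Comp} :
    p ∈ hX.toComp.range ↔ ∃ ν : MulAut H, IsEquivalence (X.twist p) X ν :=
  ⟨fun ⟨ν, hν⟩ => ⟨ν, hX.toComp_eq_iff.1 hν⟩,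
    fun ⟨ν, hν⟩ => ⟨⟨ν, hν.mem_aut_of_twist⟩, hX.toComp_eq_iff.2 hν⟩⟩

end HasKernel

end Automorphisms

section ClassShift

variable {ω : G × G → N} {c c' : S.H₂ss}

theorem isClassShift_mk_iff (hX : X.HasFactorSystem S.toFun ω) (β : S.Z₂ss) :
    IsClassShift S (β : S.H₂ss) X X' ↔ X'.HasFactorSystem S.toFun (β.1 • ω) := by
  refine ⟨fun ⟨β', ω', hβ, hX₁, hX'⟩ => ?_, fun hX' => ⟨β, ω, rfl, hX, hX'⟩⟩
  obtain ⟨b, hb, rfl⟩ := hX.exists_mem_B₂ hX₁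
  have h := HasFactorSystem.smul_of_mem_B₂ (ω := β'.1 • b • ω) hX'
    (mul_mem (S.H₂ss_mk_eq_mk_iff.1 hβ) (inv_mem hb))
  have e : β.1 = β'.1⁻¹ * β.1 * b⁻¹ * β'.1 * b := by
    rw [mul_right_comm, inv_mul_cancel_right, mul_right_comm, inv_mul_cancel, one_mul]
  rwa [smul_smul, smul_smul, ← e] at h

namespace IsClassShift

theorem unique (h : IsClassShift S c X X') (h' : IsClassShift S c' X X') : c = c' := by
  obtain ⟨β, ω, rfl, hX, hX'⟩ := h
  obtain ⟨β', rfl⟩ := QuotientGroup.mk_surjective c'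
  obtain ⟨b, hb, e⟩ := HasFactorSystem.exists_mem_B₂ (ω := β.1 • ω) hX'
    ((isClassShift_mk_iff hX β').1 h')
  rw [smul_smul] at e
  rwa [S.H₂ss_mk_eq_mk_iff, center_smul_right_cancel e, mul_comm b, inv_mul_cancel_left]

theorem trans (h : IsClassShift S c X X') (h' : IsClassShift S c' X' X'') :
    IsClassShift S (c' * c) X X'' := by
  obtain ⟨β, ω, rfl, hX, hX'⟩ := h
  obtain ⟨β', rfl⟩ := QuotientGroup.mk_surjective c'
  have h := (isClassShift_mk_iff (ω := β.1 • ω) hX' β').1 h'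
  rw [smul_smul] at h
  exact (isClassShift_mk_iff hX (β' * β)).2 h

theorem twist (h : IsClassShift S c X X') (p : S.Comp) :
    IsClassShift S (p • c) (X.twist p) (X'.twist p) := by
  obtain ⟨β, ω, rfl, hX, hX'⟩ := h
  obtain ⟨h, hh, e⟩ := p.2
  have hX' := (HasFactorSystem.twist (ω := β.1 • ω) hX' p).shift hh e
  rw [pairPull₂_center_smul, shiftCocycle_center_smul] at hX'
  exact ⟨⟨_, S.pull_mem_Z₂ss p.2 β.2⟩, _, rfl, (hX.twist p).shift hh e, hX'⟩

end IsClassShift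

end ClassShift

section Obstruction

namespace HasKernel

theorem exists_isClassShift (hX : X.HasKernel S) (hX' : X'.HasKernel S) :
    ∃ c, IsClassShift S c X X' := by
  obtain ⟨ω, hω⟩ := hX.exists_hasFactorSystem
  obtain ⟨ω', hω'⟩ := hX'.exists_hasFactorSystem
  obtain ⟨β, hβ, rfl⟩ := hω.exists_mem_Z₂ss hω'
  exact ⟨_, ⟨β, hβ⟩, ω, rfl, hω, hω'⟩

theorem isClassShift_one_iff (hX : X.HasKernel S) :
    IsClassShift S 1 X X' ↔ ∃ f : H' ≃* H, IsEquivalence X' X f := by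
  obtain ⟨ω, hω⟩ := hX.exists_hasFactorSystem
  obtain ⟨σ, hσ⟩ := hω.exists_isFactorSection
  rw [← QuotientGroup.mk_one, isClassShift_mk_iff hω, OneMemClass.coe_one, one_smul]
  refine ⟨fun hω' => ?_, fun ⟨f, hf⟩ => (hσ.map hf.symm).hasFactorSystem⟩
  obtain ⟨σ', hσ'⟩ := hω'.exists_isFactorSection
  exact (hσ'.exists_isEquivalence hσ).imp fun _ => And.left

/-- The cocycle `I : Comp(S) → H²_ss(G, Z(N))_S`: `I(p)` is the class with `p.[Ĝ] = I(p).[Ĝ]`. -/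
noncomputable def obstruction (hX : X.HasKernel S) (p : S.Comp) : S.H₂ss :=
  (hX.exists_isClassShift (hX.twist p)).choose

theorem isClassShift_obstruction (hX : X.HasKernel S) (p : S.Comp) :
    IsClassShift S (hX.obstruction p) X (X.twist p) :=
  (hX.exists_isClassShift (hX.twist p)).choose_spec

theorem isClassShift_twist_iff (hX : X.HasKernel S) (p : S.Comp) (c : S.H₂ss) :
    IsClassShift S c X (X.twist p) ↔ c = hX.obstruction p :=
  ⟨fun h => h.unique (hX.isClassShift_obstruction p), fun h => h ▸ hX.isClassShift_obstruction p⟩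

theorem obstruction_mul (hX : X.HasKernel S) (p p' : S.Comp) :
    hX.obstruction (p * p') = p • hX.obstruction p' * hX.obstruction p := by
  have h := (hX.isClassShift_obstruction p).trans ((hX.isClassShift_obstruction p').twist p)
  rw [twist_twist] at h
  exact ((hX.isClassShift_twist_iff (p * p') _).1 h).symm

theorem mem_range_toComp_iff (hX : X.HasKernel S) (p : S.Comp) :
    p ∈ hX.toComp.range ↔ hX.obstruction p = 1 :=
  calc p ∈ hX.toComp.range
      ↔ ∃ ν : MulAut H, IsEquivalence (X.twist p) X ν := hX.mem_range_toComp_iff_exists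
    _ ↔ IsClassShift S 1 X (X.twist p) := hX.isClassShift_one_iff.symm
    _ ↔ hX.obstruction p = 1 := (hX.isClassShift_twist_iff p 1).trans eq_comm

end HasKernel

end Obstruction

end LieGroupExtension

theorem theoremA9 {K EN EH EG N H G : Type*} [RCLike K]
    [AddCommGroup EN] [Module K EN] [TopologicalSpace EN] [LocallyConvexTVS K EN]
    [AddCommGroup EH] [Module K EH] [TopologicalSpace EH] [LocallyConvexTVS K EH]
    [AddCommGroup EG] [Module K EG] [TopologicalSpace EG] [LocallyConvexTVS K EG]
    [Group N] [TopologicalSpace N] [ChartedSpace EN N] [LCLieGroup K EN N]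
    [Group H] [TopologicalSpace H] [ChartedSpace EH H] [LCLieGroup K EH H]
    [Group G] [TopologicalSpace G] [ChartedSpace EG G] [LCLieGroup K EG G]
    (S : SmoothOuterAction K EG EN G N) (X : LieGroupExtension K EN EH EG N H G)
    (hX : X.HasKernel S) :
    ∃ (Ψ : S.Z₁ →* X.Aut) (Φ : X.Aut →* S.Comp) (I : S.Comp → S.H₂ss),
      (∀ (f : S.Z₁) (x : H), (Ψ f : MulAut H) x = X.ι (f.1 (X.q x)) * x) ∧
      (∀ (ν : X.Aut) (n : N), X.ι (((Φ ν).1.1 : MulAut N) n) = (ν : MulAut H) (X.ι n)) ∧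
      (∀ (ν : X.Aut) (x : H), ((Φ ν).1.2 : MulAut G) (X.q x) = X.q ((ν : MulAut H) x)) ∧
      (∀ (p : S.Comp) (c : S.H₂ss),
        LieGroupExtension.IsClassShift S c X (X.twist p) ↔ c = I p) ∧
      (∀ p p' : S.Comp, I (p * p') = p • I p' * I p) ∧
      Function.Injective Ψ ∧ Ψ.range = Φ.ker ∧ (∀ p : S.Comp, p ∈ Φ.range ↔ I p = 1) := by
  exact ⟨hX.ofCocycle, hX.toComp, hX.obstruction,
    hX.ofCocycle_apply, hX.ι_toComp_apply, hX.toComp_apply_q,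
    hX.isClassShift_twist_iff, hX.obstruction_mul,
    hX.ofCocycle_injective, hX.range_ofCocycle, hX.mem_range_toComp_iff⟩
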